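/- \textbf{Definitions.} Let $\omega$ denote the exponent of matrix multiplication over $\mathbb{C}$: the smallest real number such that for each $\varepsilon>0$ two complex $n\times n$ matrices can be multiplied with $O(n^{\omega+\varepsilon})$ field operations. Here an algorithm for a given $n$ is a straight-line program over $\mathbb{C}$ that starts from the entries of the two matrices and arbitrary complex constants, uses the operations $+,-,\times,/$ (each counted once), and is correct, without division by zero, on every input. A finite group $G$ \emph{realizes} $\langle n,m,p\rangle$ if there are subsets $S_1,S_2,S_3\subseteq G$ with $|S_1|=n$, $|S_2|=m$, $|S_3|=p$ such that, for all $q_i\in Q(S_i)=\{st^{-1}: s,t\in S_i\}$, $q_1q_2q_3=1$ implies $q_1=q_2=q_3=1$. The \emph{pseudo-exponent} $\alpha(G)$ of a non-trivial finite group $G$ is the minimum of $$\frac{3\log|G|}{\log (nmp)}$$ over all positive integers $n,m,p$, not all equal to $1$, such that $G$ realizes $\langle n,m,p\rangle$; the pseudo-exponent of the trivial group is $3$. Let $d_{\max}(G)$ be the maximum dimension of an irreducible complex representation of $G$. For non-abelian $G$ define $\gamma(G)$ by $|G|^{1/\gamma(G)}=d_{\max}(G)$, and put $\gamma(G)=\infty$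 if $G$ is abelian. \textbf{Statement.} Suppose there exists a family $G_1,G_2,\dots$ of finite groups such that $\alpha(G_i)=2+o(1)$ as $i\to\infty$, and furthermore $\alpha(G_i)-2=o(\gamma(G_i)-2)$, that is, for every $c>0$ one has $|\alpha(G_i)-2|\le c\,(\gamma(G_i)-2)$ for all sufficiently large $i$ (a condition that holds trivially for those $i$ with $\gamma(G_i)=\infty$). Then the exponent of matrix multiplication is $\omega=2$. -/

import Mathlib

/-! ### Straight-line computations over `ℂ` and the exponent of matrix multiplication -/

/-- `f` arises from the functions in `S` by one field operation `+`, `-`, `*`, `/`, carried out on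
every input; a division is admissible only when the divisor vanishes at no input. -/
inductive ArithStep {X : Type*} (S : Set (X → ℂ)) : (X → ℂ) → Prop
  | add {f g : X → ℂ} : f ∈ S → g ∈ S → ArithStep S (fun x => f x + g x)
  | sub {f g : X → ℂ} : f ∈ S → g ∈ S → ArithStep S (fun x => f x - g x)
  | mul {f g : X → ℂ} : f ∈ S → g ∈ S → ArithStep S (fun x => f x * g x)
  | div {f g : X → ℂ} : f ∈ S → g ∈ S → (∀ x, g x ≠ 0) → ArithStep S (fun x => f x / g x)

/-- What is at hand, free of charge, after the intermediate results `L` have been computed: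
the inputs, the complex constants, and the results in `L`. -/
def availableValues {X : Type*} (inputs : Set (X → ℂ)) (L : List (X → ℂ)) : Set (X → ℂ) :=
  inputs ∪ Set.range (fun c : ℂ => fun _ : X => c) ∪ {f | f ∈ L}

/-- `L` lists the results, the latest one first, of the operations of a straight-line program on
the given inputs. Each entry of `L` costs one operation. -/
inductive IsComputation {X : Type*} (inputs : Set (X → ℂ)) : List (X → ℂ) → Prop
  | nil : IsComputation inputs []
  | cons {f : X → ℂ} {L : List (X → ℂ)} : IsComputation inputs L →
      ArithStep (availableValues inputs L) f → IsComputation inputs (f :: L)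

/-- The `2 n ^ 2` input functions of `n × n` matrix multiplication: the entries of the two
factors. -/
def matMulInputs (n : ℕ) :
    Set (Matrix (Fin n) (Fin n) ℂ × Matrix (Fin n) (Fin n) ℂ → ℂ) :=
  {f | ∃ i j : Fin n, (f = fun P => P.1 i j) ∨ (f = fun P => P.2 i j)}

/-- Two complex `n × n` matrices can be multiplied with at most `k` field operations. -/
def MatMulWithin (n k : ℕ) : Prop :=
  ∃ L : List (Matrix (Fin n) (Fin n) ℂ × Matrix (Fin n) (Fin n) ℂ → ℂ),
    IsComputation (matMulInputs n) L ∧ L.length ≤ k ∧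
      ∀ i j : Fin n, (fun P => (P.1 * P.2) i j) ∈ availableValues (matMulInputs n) L

/-- The exponent of matrix multiplication over `ℂ`: the smallest `w` such that, for each `ε > 0`,
`n × n` matrices can be multiplied with `O(n ^ (w + ε))` field operations. -/
noncomputable def matMulExponent : ℝ :=
  sInf {w : ℝ | ∀ ε : ℝ, 0 < ε → ∃ C : ℝ, ∀ n : ℕ, 1 ≤ n →
    ∃ k : ℕ, MatMulWithin n k ∧ (k : ℝ) ≤ C * (n : ℝ) ^ (w + ε)}

/-! ### The triple product property and the pseudo-exponent -/

/-- The right quotient set of a subset of a group. -/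
def rightQuotientSet {G : Type*} [Group G] (S : Finset G) : Set G :=
  {q | ∃ s ∈ S, ∃ t ∈ S, q = s * t⁻¹}

/-- The triple product property of three subsets of a group. -/
def TripleProductProperty {G : Type*} [Group G] (S T U : Finset G) : Prop :=
  ∀ a ∈ rightQuotientSet S, ∀ b ∈ rightQuotientSet T, ∀ c ∈ rightQuotientSet U,
    a * b * c = 1 → a = 1 ∧ b = 1 ∧ c = 1

/-- The group `G` realizes `⟨n, m, p⟩`. -/
def Realizes (G : Type*) [Group G] (n m p : ℕ) : Prop :=
  ∃ S T U : Finset G, S.card = n ∧ T.card = m ∧ U.card = p ∧ TripleProductProperty S T U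

open scoped Classical in
/-- The pseudo-exponent of a finite group. The sizes `n, m, p` are positive: empty subsets would
satisfy the triple product property vacuously. -/
noncomputable def pseudoExponent (G : Type*) [Group G] : ℝ :=
  if Nontrivial G then
    sInf {x : ℝ | ∃ n m p : ℕ, 0 < n ∧ 0 < m ∧ 0 < p ∧ ¬ (n = 1 ∧ m = 1 ∧ p = 1) ∧
      Realizes G n m p ∧
      x = 3 * Real.log (Nat.card G) / Real.log ((n : ℝ) * (m : ℝ) * (p : ℝ))}
  else 3

/-! ### Character degrees -/

/-- `d` is a character degree of `G`: the dimension of an irreducible complex representation. -/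
def IsCharacterDegree (G : Type*) [Group G] (d : ℕ) : Prop :=
  ∃ ρ : Representation ℂ G (Fin d → ℂ), ρ.IsIrreducible

/-- The maximum character degree of a finite group. -/
noncomputable def maxCharacterDegree (G : Type*) [Group G] : ℕ :=
  sSup {d : ℕ | IsCharacterDegree G d}

open scoped Classical in
/-- The number `γ` for which `|G| ^ (1 / γ)` is the maximum character degree `d` of `G`, that is,
`γ = log |G| / log d`; it is infinite when `G` is abelian. -/
noncomputable def degreeExponent (G : Type*) [Group G] : EReal :=
  if ∀ a b : G, a * b = b * a then ⊤
  else ((Real.log (Nat.card G) / Real.log (maxCharacterDegree G) : ℝ) : EReal)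

/-!
A straight-line program of length `k` for the product of two matrices yields a bilinear algorithm
with at most `2 k` products: restrict every intermediate result to lines through the origin and
keep only its quadratic part. Divisions disappear in this process, because a divisor without zeros
is a constant. Conversely, if the tensor `⟨q, q, q⟩` has rank less than `q ^ w`, then recursion
multiplies `n × n` matrices in `O(n ^ w)` operations. Hence `ω` is governed by the ranks of matrix
multiplication tensors.

The triple product property embeds `⟨n, m, p⟩` into the multiplication of `ℂ[G]`, which is a
product of matrix algebras. With `ω = matMulExponent` and `d = d_max(G)` this gives
`(nmp) ^ (ω / 3) ≤ d ^ (ω - 2) * |G|`, and after taking logarithms `(ω - 2) (γ - α) ≤ (α - 2) γ`,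
that is, `(ω - 2) (γ - 2) ≤ (α - 2) (γ - 2) + ω (α - 2)`. Dividing by `γ - 2` and letting `α → 2`
with `α - 2 = o(γ - 2)` forces `ω = 2`.
-/

/-! ### Straight-line programs -/

section StraightLine

variable {X : Type*} {inputs inputs' F F' H : Set (X → ℂ)} {k k' : ℕ}

/-- The functions in `F` can be computed from `inputs` with at most `k` field operations. -/
def ComputesWithin (inputs F : Set (X → ℂ)) (k : ℕ) : Prop :=
  ∃ L : List (X → ℂ), IsComputation inputs L ∧ L.length ≤ k ∧ F ⊆ availableValues inputs L

theorem ArithStep.mono {S T : Set (X → ℂ)} (hST : S ⊆ T) {f : X → ℂ} (hf : ArithStep S f) :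
    ArithStep T f := by
  cases hf with
  | add hf hg => exact .add (hST hf) (hST hg)
  | sub hf hg => exact .sub (hST hf) (hST hg)
  | mul hf hg => exact .mul (hST hf) (hST hg)
  | div hf hg hg₀ => exact .div (hST hf) (hST hg) hg₀

theorem subset_availableValues (inputs : Set (X → ℂ)) (L : List (X → ℂ)) :
    inputs ⊆ availableValues inputs L :=
  fun _ hf => Or.inl (Or.inl hf)

theorem const_mem_availableValues (inputs : Set (X → ℂ)) (L : List (X → ℂ)) (c : ℂ) :
    (fun _ => c) ∈ availableValues inputs L :=
  Or.inl (Or.inr ⟨c, rfl⟩)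

theorem availableValues_subset_append (inputs : Set (X → ℂ)) (L L' : List (X → ℂ)) :
    availableValues inputs L ⊆ availableValues inputs (L' ++ L) :=
  Set.union_subset_union_right _ fun _ hf => List.mem_append_right _ hf

theorem availableValues_append_subset {L : List (X → ℂ)}
    (h : inputs' ⊆ availableValues inputs L) (L' : List (X → ℂ)) :
    availableValues inputs' L' ⊆ availableValues inputs (L' ++ L) := by
  rintro f ((hf | ⟨c, rfl⟩) | hf)
  · exact availableValues_subset_append _ _ _ (h hf)
  · exact const_mem_availableValues _ _ c
  · exact Or.inr (List.mem_append_left _ hf)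

theorem IsComputation.append {L L' : List (X → ℂ)} (hL : IsComputation inputs L)
    (h : inputs' ⊆ availableValues inputs L) (hL' : IsComputation inputs' L') :
    IsComputation inputs (L' ++ L) := by
  induction hL' with
  | nil => exact hL
  | cons _ hf ih => exact .cons ih (hf.mono (availableValues_append_subset h _))

namespace ComputesWithin

theorem of_subset_availableValues (h : F ⊆ availableValues inputs []) :
    ComputesWithin inputs F 0 :=
  ⟨[], .nil, le_rfl, h⟩

theorem of_subset (h : F ⊆ inputs) : ComputesWithin inputs F 0 :=
  of_subset_availableValues (h.trans (subset_availableValues _ _))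

theorem of_arithStep {f : X → ℂ} (h : ArithStep (availableValues inputs []) f) :
    ComputesWithin inputs {f} 1 :=
  ⟨[f], .cons .nil h, le_rfl,
    Set.singleton_subset_iff.2 (Or.inr (List.mem_singleton.2 rfl))⟩

theorem mono (h : ComputesWithin inputs F k) (hF : F' ⊆ F) (hk : k ≤ k') :
    ComputesWithin inputs F' k' :=
  let ⟨L, hL, hlen, hsub⟩ := h
  ⟨L, hL, hlen.trans hk, hF.trans hsub⟩

theorem trans (hF : ComputesWithin inputs F k) (hH : ComputesWithin F H k') :
    ComputesWithin inputs H (k + k') := by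
  obtain ⟨L, hL, hlen, hsub⟩ := hF
  obtain ⟨L', hL', hlen', hsub'⟩ := hH
  refine ⟨L' ++ L, hL.append hsub hL', ?_, hsub'.trans (availableValues_append_subset hsub L')⟩
  rw [List.length_append]
  omega

theorem inputs_mono (h : ComputesWithin inputs F k) (hi : inputs ⊆ inputs') :
    ComputesWithin inputs' F k := by
  simpa using (of_subset hi).trans h

theorem union (hF : ComputesWithin inputs F k) (hH : ComputesWithin inputs H k') :
    ComputesWithin inputs (F ∪ H) (k + k') := by
  obtain ⟨L, hL, hlen, hsub⟩ := hF
  obtain ⟨L', hL', hlen', hsub'⟩ := hH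
  have hi := subset_availableValues inputs L
  refine ⟨L' ++ L, hL.append hi hL', ?_, Set.union_subset ?_ ?_⟩
  · rw [List.length_append]
    omega
  · exact hsub.trans (availableValues_subset_append inputs L L')
  · exact hsub'.trans (availableValues_append_subset hi L')

theorem biUnion {ι : Type*} {F : ι → Set (X → ℂ)} {k : ι → ℕ} (s : Finset ι)
    (h : ∀ i ∈ s, ComputesWithin inputs (F i) (k i)) :
    ComputesWithin inputs (⋃ i ∈ s, F i) (∑ i ∈ s, k i) := by
  classical
  induction s using Finset.induction_on with
  | empty => simpa using of_subset (Set.empty_subset inputs)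
  | insert a s ha ih =>
    rw [Finset.sum_insert ha, Finset.set_biUnion_insert]
    exact (h a (Finset.mem_insert_self a s)).union
      (ih fun i hi => h i (Finset.mem_insert_of_mem hi))

theorem iUnion {ι : Type*} [Fintype ι] {F : ι → Set (X → ℂ)}
    (h : ∀ i, ComputesWithin inputs (F i) k) :
    ComputesWithin inputs (⋃ i, F i) (Fintype.card ι * k) := by
  simpa using biUnion Finset.univ fun i _ => h i

theorem range {ι : Type*} [Fintype ι] {f : ι → X → ℂ}
    (h : ∀ i, ComputesWithin inputs {f i} k) :
    ComputesWithin inputs (Set.range f) (Fintype.card ι * k) := by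
  simpa using iUnion h

theorem add {f g : X → ℂ} (hf : ComputesWithin inputs {f} k)
    (hg : ComputesWithin inputs {g} k') : ComputesWithin inputs {f + g} (k + k' + 1) :=
  (hf.union hg).trans (of_arithStep (.add (f := f) (g := g)
    (subset_availableValues _ _ (Or.inl rfl)) (subset_availableValues _ _ (Or.inr rfl))))

theorem sum_smul {ι : Type*} (s : Finset ι) (c : ι → ℂ) {f : ι → X → ℂ}
    (hf : ∀ i ∈ s, f i ∈ inputs) :
    ComputesWithin inputs {∑ i ∈ s, c i • f i} (2 * s.card) := by
  classical
  induction s using Finset.induction_on with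
  | empty =>
    exact of_subset_availableValues
      (Set.singleton_subset_iff.2 (const_mem_availableValues inputs [] 0))
  | insert a s ha ih =>
    have ha_smul : ComputesWithin inputs {c a • f a} 1 :=
      of_arithStep (.mul (const_mem_availableValues _ _ (c a))
        (subset_availableValues _ _ (hf a (Finset.mem_insert_self a s))))
    rw [Finset.sum_insert ha, Finset.card_insert_of_notMem ha]
    exact (ha_smul.add (ih fun i hi => hf i (Finset.mem_insert_of_mem hi))).mono
      subset_rfl (by omega)

end ComputesWithin

end StraightLine

/-! ### Quadratic parts of straight-line programs -/

section TwoJet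

open Polynomial

/-- Along each line through the origin, `f` is polynomial with constant term `c`, linear term `l`
and quadratic term `q`. -/
def HasTwoJet {K E : Type*} [CommSemiring K] [AddCommMonoid E] [Module K E]
    (f : E → K) (c : K) (l : Module.Dual K E) (q : E → K) : Prop :=
  ∀ x, ∃ p : K[X], (∀ t, f (t • x) = p.eval t) ∧
    p.coeff 0 = c ∧ p.coeff 1 = l x ∧ p.coeff 2 = q x

namespace HasTwoJet

section CommSemiring

variable {K E : Type*} [CommSemiring K] [AddCommMonoid E] [Module K E]
  {f g : E → K} {c d : K} {l m : Module.Dual K E} {q s : E → K}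

theorem const (c : K) : HasTwoJet (fun _ : E => c) c 0 0 := fun _ =>
  ⟨C c, fun _ => eval_C.symm, coeff_C_zero, coeff_C_succ, coeff_C_succ⟩

theorem linear (l : Module.Dual K E) : HasTwoJet l 0 l 0 := fun x =>
  ⟨C (l x) * X, fun t => by rw [map_smul, smul_eq_mul, eval_C_mul, eval_X, mul_comm],
    by simp, by simp, by simp⟩

theorem add (hf : HasTwoJet f c l q) (hg : HasTwoJet g d m s) :
    HasTwoJet (f + g) (c + d) (l + m) (q + s) := fun x => by
  obtain ⟨p, hp, hp₀, hp₁, hp₂⟩ := hf x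
  obtain ⟨r, hr, hr₀, hr₁, hr₂⟩ := hg x
  exact ⟨p + r, fun t => by simp [hp, hr], by simp [hp₀, hr₀], by simp [hp₁, hr₁],
    by simp [hp₂, hr₂]⟩

theorem smul (a : K) (hf : HasTwoJet f c l q) : HasTwoJet (a • f) (a • c) (a • l) (a • q) :=
  fun x => by
    obtain ⟨p, hp, hp₀, hp₁, hp₂⟩ := hf x
    exact ⟨a • p, fun t => by simp [hp], by simp [hp₀], by simp [hp₁], by simp [hp₂]⟩

theorem mul (hf : HasTwoJet f c l q) (hg : HasTwoJet g d m s) :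
    HasTwoJet (f * g) (c * d) (c • m + d • l) (c • s + d • q + fun x => l x * m x) :=
  fun x => by
    obtain ⟨p, hp, rfl, hp₁, hp₂⟩ := hf x
    obtain ⟨r, hr, rfl, hr₁, hr₂⟩ := hg x
    refine ⟨p * r, fun t => by simp [hp, hr], mul_coeff_zero p r, ?_, ?_⟩
    · simp [mul_coeff_one, hp₁, hr₁, mul_comm]
    · simp only [coeff_mul, Finset.Nat.antidiagonal_succ, Finset.Nat.antidiagonal_zero,
        Finset.map_singleton, Finset.sum_cons, Finset.map_cons, Finset.sum_singleton,
        Pi.add_apply, Pi.smul_apply, smul_eq_mul, ← hp₁, ← hp₂, ← hr₁, ← hr₂, Nat.reduceAdd,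
        zero_add, Function.Embedding.coe_prodMap, Function.Embedding.coeFn_mk, Prod.map_apply,
        Nat.succ_eq_add_one, Function.Embedding.refl_apply]
      ring

end CommSemiring

theorem eq_of_homogeneous {K E : Type*} [CommRing K] [IsDomain K] [Infinite K]
    [AddCommMonoid E] [Module K E] {f : E → K} {c : K} {l : Module.Dual K E} {q : E → K}
    (hf : HasTwoJet f c l q) (hhom : ∀ (t : K) x, f (t • x) = t ^ 2 * f x) : q = f := by
  funext x
  obtain ⟨p, hp, -, -, hp₂⟩ := hf x
  have hp_eq : p = C (f x) * X ^ 2 := Polynomial.funext fun t => by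
    rw [← hp, hhom, eval_mul, eval_C, eval_pow, eval_X, mul_comm]
  rw [← hp₂, hp_eq, coeff_C_mul_X_pow, if_pos rfl]

/-- A nonvanishing polynomial over an algebraically closed field is constant, so a divisor that is
nonzero on every input is a constant. -/
theorem eq_const_of_forall_ne_zero {K E : Type*} [Field K] [IsAlgClosed K] [AddCommMonoid E]
    [Module K E] {f : E → K} {c : K} {l : Module.Dual K E} {q : E → K}
    (hf : HasTwoJet f c l q) (hne : ∀ x, f x ≠ 0) (x : E) : f x = c := by
  obtain ⟨p, hp, hp₀, -, -⟩ := hf x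
  have hdeg : p.degree = 0 := by
    by_contra hdeg
    obtain ⟨t, ht⟩ := IsAlgClosed.exists_root p hdeg
    exact hne (t • x) ((hp t).trans ht)
  have hx : f x = p.eval 1 := by rw [← hp, one_smul]
  rw [hx, eq_C_of_degree_eq_zero hdeg, eval_C, hp₀]

end HasTwoJet

section QuadraticPart

variable {K E : Type*} [CommSemiring K] [AddCommMonoid E] [Module K E]

/-- The space of quadratic forms spanned by the products of the pairs of linear forms in `P`. -/
def productSpan (P : Set (Module.Dual K E × Module.Dual K E)) : Submodule K (E → K) :=
  Submodule.span K ((fun p x => p.1 x * p.2 x) '' P)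

theorem productSpan_mono {P Q : Set (Module.Dual K E × Module.Dual K E)} (h : P ⊆ Q) :
    productSpan P ≤ productSpan Q :=
  Submodule.span_mono (Set.image_mono h)

theorem mul_mem_productSpan {P : Set (Module.Dual K E × Module.Dual K E)}
    {l m : Module.Dual K E} (h : (l, m) ∈ P) : (fun x => l x * m x) ∈ productSpan P :=
  Submodule.subset_span ⟨(l, m), h, rfl⟩

/-- `f` has a second-order expansion along lines whose quadratic term lies in `V`. -/
def HasQuadraticPartIn (V : Submodule K (E → K)) (f : E → K) : Prop :=
  ∃ c l q, HasTwoJet f c l q ∧ q ∈ V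

namespace HasQuadraticPartIn

variable {V W : Submodule K (E → K)} {f g : E → K}

theorem mono (hf : HasQuadraticPartIn V f) (h : V ≤ W) : HasQuadraticPartIn W f :=
  let ⟨c, l, q, hq, hqV⟩ := hf
  ⟨c, l, q, hq, h hqV⟩

theorem const (V : Submodule K (E → K)) (c : K) : HasQuadraticPartIn V fun _ => c :=
  ⟨c, 0, 0, .const c, zero_mem V⟩

theorem linear (V : Submodule K (E → K)) (l : Module.Dual K E) : HasQuadraticPartIn V l :=
  ⟨0, l, 0, .linear l, zero_mem V⟩

theorem add (hf : HasQuadraticPartIn V f) (hg : HasQuadraticPartIn V g) :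
    HasQuadraticPartIn V (f + g) :=
  let ⟨_, _, _, hq, hqV⟩ := hf
  let ⟨_, _, _, hs, hsV⟩ := hg
  ⟨_, _, _, hq.add hs, add_mem hqV hsV⟩

theorem smul (a : K) (hf : HasQuadraticPartIn V f) : HasQuadraticPartIn V (a • f) :=
  let ⟨_, _, _, hq, hqV⟩ := hf
  ⟨_, _, _, hq.smul a, V.smul_mem a hqV⟩

end HasQuadraticPartIn

end QuadraticPart

section Complex

variable {E : Type*} [AddCommMonoid E] [Module ℂ E]

theorem ArithStep.exists_hasQuadraticPartIn {S : Set (E → ℂ)}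
    {P : Set (Module.Dual ℂ E × Module.Dual ℂ E)}
    (hS : ∀ f ∈ S, HasQuadraticPartIn (productSpan P) f) {f : E → ℂ} (hf : ArithStep S f) :
    ∃ p, HasQuadraticPartIn (productSpan (insert p P)) f := by
  have hmono (p) : productSpan P ≤ productSpan (insert p P) :=
    productSpan_mono (Set.subset_insert p P)
  cases hf with
  | @add f g hf hg => exact ⟨0, ((hS f hf).add (hS g hg)).mono (hmono 0)⟩
  | @sub f g hf hg =>
    have hsub : (fun x => f x - g x) = f + (-1 : ℂ) • g := by
      funext x
      simp [sub_eq_add_neg]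
    exact ⟨0, hsub ▸ ((hS f hf).add ((hS g hg).smul (-1))).mono (hmono 0)⟩
  | mul hf hg =>
    obtain ⟨c, l, q, hq, hqP⟩ := hS _ hf
    obtain ⟨d, m, s, hs, hsP⟩ := hS _ hg
    exact ⟨(l, m), _, _, _, hq.mul hs, add_mem
      (hmono _ (add_mem (Submodule.smul_mem _ c hsP) (Submodule.smul_mem _ d hqP)))
      (mul_mem_productSpan (Set.mem_insert _ P))⟩
  | @div f g hf hg hg₀ =>
    obtain ⟨d, m, s, hs, -⟩ := hS g hg
    have hdiv : (fun x => f x / g x) = d⁻¹ • f := by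
      funext x
      simp [hs.eq_const_of_forall_ne_zero hg₀ x, div_eq_inv_mul]
    exact ⟨0, hdiv ▸ ((hS f hf).smul d⁻¹).mono (hmono 0)⟩

theorem IsComputation.exists_productSpan {inputs : Set (E → ℂ)}
    (hin : ∀ f ∈ inputs, ∃ l : Module.Dual ℂ E, f = l) {L : List (E → ℂ)}
    (hL : IsComputation inputs L) :
    ∃ P : Finset (Module.Dual ℂ E × Module.Dual ℂ E), P.card ≤ L.length ∧
      ∀ f ∈ availableValues inputs L, HasQuadraticPartIn (productSpan P) f := by
  classical
  induction hL with
  | nil =>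
    refine ⟨∅, le_rfl, ?_⟩
    rintro f ((hf | ⟨c, rfl⟩) | hf)
    · obtain ⟨l, rfl⟩ := hin f hf
      exact .linear _ l
    · exact .const _ c
    · simp at hf
  | @cons f L _ hf ih =>
    obtain ⟨P, hcard, hP⟩ := ih
    obtain ⟨p, hp⟩ := hf.exists_hasQuadraticPartIn hP
    refine ⟨insert p P, (Finset.card_insert_le p P).trans (Nat.succ_le_succ hcard), ?_⟩
    rw [Finset.coe_insert]
    have hold (g) (hg : g ∈ availableValues inputs L) :
        HasQuadraticPartIn (productSpan (insert p ↑P)) g :=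
      (hP g hg).mono (productSpan_mono (Set.subset_insert p ↑P))
    rintro g (hg | hg)
    · exact hold g (Or.inl hg)
    · rcases List.mem_cons.1 hg with rfl | hg
      · exact hp
      · exact hold g (Or.inr hg)

end Complex

end TwoJet

theorem MatMulWithin.exists_productSpan {n k : ℕ} (h : MatMulWithin n k) :
    ∃ P : Finset (Module.Dual ℂ (Matrix (Fin n) (Fin n) ℂ × Matrix (Fin n) (Fin n) ℂ) ×
        Module.Dual ℂ (Matrix (Fin n) (Fin n) ℂ × Matrix (Fin n) (Fin n) ℂ)),
      P.card ≤ k ∧ ∀ i j, (fun A : Matrix (Fin n) (Fin n) ℂ × Matrix (Fin n) (Fin n) ℂ =>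
        (A.1 * A.2) i j) ∈ productSpan P := by
  obtain ⟨L, hL, hk, hout⟩ := h
  obtain ⟨P, hcard, hP⟩ := hL.exists_productSpan (by
    rintro f ⟨i, j, rfl | rfl⟩
    · exact ⟨Matrix.entryLinearMap ℂ ℂ i j ∘ₗ LinearMap.fst ℂ _ _, rfl⟩
    · exact ⟨Matrix.entryLinearMap ℂ ℂ i j ∘ₗ LinearMap.snd ℂ _ _, rfl⟩)
  refine ⟨P, hcard.trans hk, fun i j => ?_⟩
  obtain ⟨c, l, q, hq, hqP⟩ := hP _ (hout i j)
  rwa [hq.eq_of_homogeneous fun t A => by simp [sq, mul_assoc]] at hqP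

/-! ### Tensor rank -/

section TensorRank

variable {R I J K I' J' K' S S' S'' : Type*} [CommSemiring R]

/-- The rank of the tensor with coefficients `T`: the least number of rank-one tensors with sum
`T`. It is always attained when two of the index types are finite. -/
noncomputable def tensorRank (T : I → J → K → R) : ℕ :=
  sInf {r | ∃ (u : Fin r → I → R) (v : Fin r → J → R) (w : Fin r → K → R),
    ∀ i j k, T i j k = ∑ t, u t i * v t j * w t k}

theorem tensorRank_le_card {ι : Type*} [Fintype ι] {T : I → J → K → R} (u : ι → I → R)
    (v : ι → J → R) (w : ι → K → R) (h : ∀ i j k, T i j k = ∑ t, u t i * v t j * w t k) :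
    tensorRank T ≤ Fintype.card ι := by
  let e := (Fintype.equivFin ι).symm
  exact Nat.sInf_le ⟨u ∘ e, v ∘ e, w ∘ e, fun i j k =>
    (h i j k).trans (e.sum_comp fun t => u t i * v t j * w t k).symm⟩

theorem exists_eq_sum_tensorRank [Finite J] [Finite K] (T : I → J → K → R) :
    ∃ (u : Fin (tensorRank T) → I → R) (v : Fin (tensorRank T) → J → R)
      (w : Fin (tensorRank T) → K → R), ∀ i j k, T i j k = ∑ t, u t i * v t j * w t k := by
  classical
  have := Fintype.ofFinite J
  have := Fintype.ofFinite K
  let e := (Fintype.equivFin (J × K)).symm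
  refine Nat.sInf_mem (s := {r | ∃ (u : Fin r → I → R) (v : Fin r → J → R) (w : Fin r → K → R),
    ∀ i j k, T i j k = ∑ t, u t i * v t j * w t k})
    ⟨Fintype.card (J × K), fun t i => T i (e t).1 (e t).2, fun t => Pi.single (e t).1 1,
      fun t => Pi.single (e t).2 1, fun i j k => ?_⟩
  rw [e.sum_comp fun t : J × K =>
    T i t.1 t.2 * (Pi.single t.1 1 : J → R) j * (Pi.single t.2 1 : K → R) k]
  simp [Fintype.sum_prod_type, Pi.single_apply]

theorem tensorRank_sum_le {ι : Type*} [Fintype ι] [Finite J] [Finite K]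
    (T : ι → I → J → K → R) :
    tensorRank (fun i j k => ∑ a, T a i j k) ≤ ∑ a, tensorRank (T a) := by
  choose u v w huvw using fun a => exists_eq_sum_tensorRank (T a)
  refine (tensorRank_le_card (ι := Σ a, Fin (tensorRank (T a))) (fun t => u t.1 t.2)
    (fun t => v t.1 t.2) (fun t => w t.1 t.2) fun i j k => ?_).trans (by simp)
  rw [Fintype.sum_sigma]
  exact Finset.sum_congr rfl fun a _ => huvw a i j k

theorem tensorRank_le_of_comap [Finite J] [Finite K] {T : I → J → K → R}
    {T' : I' → J' → K' → R} (f : I' → I) (g : J' → J) (h : K' → K)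
    (hT : ∀ i j k, T' i j k = T (f i) (g j) (h k)) : tensorRank T' ≤ tensorRank T := by
  obtain ⟨u, v, w, huvw⟩ := exists_eq_sum_tensorRank T
  simpa using tensorRank_le_card (fun t => u t ∘ f) (fun t => v t ∘ g) (fun t => w t ∘ h)
    fun i j k => (hT i j k).trans (huvw (f i) (g j) (h k))

theorem tensorRank_le_of_rotate [Finite J] [Finite K] {T : I → J → K → R} {T' : J → K → I → R}
    (hT : ∀ i j k, T' j k i = T i j k) : tensorRank T' ≤ tensorRank T := by
  obtain ⟨u, v, w, huvw⟩ := exists_eq_sum_tensorRank T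
  simpa using tensorRank_le_card v w u fun j k i => by
    rw [hT, huvw]
    exact Finset.sum_congr rfl fun t _ => by ring

theorem tensorRank_restrict_fst_le [Fintype S] [Finite J] [Finite K] (T : I → J → K → R)
    (a : I' → S → R) (f : I' → S → I) :
    tensorRank (fun i j k => ∑ s, a i s * T (f i s) j k) ≤ tensorRank T := by
  obtain ⟨u, v, w, huvw⟩ := exists_eq_sum_tensorRank T
  simpa using tensorRank_le_card (fun t i => ∑ s, a i s * u t (f i s)) v w fun i j k => by
    simp only [huvw, Finset.mul_sum, Finset.sum_mul]
    rw [Finset.sum_comm]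
    exact Finset.sum_congr rfl fun t _ => Finset.sum_congr rfl fun s _ => by ring

theorem tensorRank_le_of_restrict [Fintype S] [Fintype S'] [Fintype S''] [Finite I] [Finite J]
    [Finite K] [Finite I'] [Finite J'] [Finite K'] {T : I → J → K → R} {T' : I' → J' → K' → R}
    (a : I' → S → R) (b : J' → S' → R) (c : K' → S'' → R) (f : I' → S → I) (g : J' → S' → J)
    (h : K' → S'' → K)
    (hT : ∀ i j k, T' i j k = ∑ s, a i s * ∑ s', b j s' * ∑ s'', c k s'' *
      T (f i s) (g j s') (h k s'')) : tensorRank T' ≤ tensorRank T := by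
  let T₃ : I → J → K' → R := fun i j k => ∑ s'', c k s'' * T i j (h k s'')
  let T₂ : I → J' → K' → R := fun i j k => ∑ s', b j s' * T₃ i (g j s') k
  obtain rfl : T' = fun i j k => ∑ s, a i s * T₂ (f i s) j k := by
    funext i j k
    exact hT i j k
  calc _ ≤ tensorRank T₂ := tensorRank_restrict_fst_le T₂ a f
    _ ≤ tensorRank fun k i j => T₂ i j k := tensorRank_le_of_rotate fun _ _ _ => rfl
    _ ≤ tensorRank fun j k i => T₂ i j k := tensorRank_le_of_rotate fun _ _ _ => rfl
    _ ≤ tensorRank fun j k i => T₃ i j k :=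
        tensorRank_restrict_fst_le (fun j k i => T₃ i j k) b g
    _ ≤ tensorRank T₃ := tensorRank_le_of_rotate fun _ _ _ => rfl
    _ ≤ tensorRank fun k i j => T₃ i j k := tensorRank_le_of_rotate fun _ _ _ => rfl
    _ ≤ tensorRank fun k i j => T i j k :=
        tensorRank_restrict_fst_le (fun k i j => T i j k) c h
    _ ≤ tensorRank fun j k i => T i j k := tensorRank_le_of_rotate fun _ _ _ => rfl
    _ ≤ tensorRank T := tensorRank_le_of_rotate fun _ _ _ => rfl

/-- The Kronecker product of two tensors. -/
def tensorKronecker (T : I → J → K → R) (T' : I' → J' → K' → R) :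
    I × I' → J × J' → K × K' → R :=
  fun i j k => T i.1 j.1 k.1 * T' i.2 j.2 k.2

theorem tensorRank_kronecker_le [Finite J] [Finite K] [Finite J'] [Finite K']
    (T : I → J → K → R) (T' : I' → J' → K' → R) :
    tensorRank (tensorKronecker T T') ≤ tensorRank T * tensorRank T' := by
  obtain ⟨u, v, w, h⟩ := exists_eq_sum_tensorRank T
  obtain ⟨u', v', w', h'⟩ := exists_eq_sum_tensorRank T'
  refine (tensorRank_le_card
    (ι := Fin (tensorRank T) × Fin (tensorRank T')) (fun t i => u t.1 i.1 * u' t.2 i.2)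
    (fun t j => v t.1 j.1 * v' t.2 j.2) (fun t k => w t.1 k.1 * w' t.2 k.2)
    fun i j k => ?_).trans (by simp)
  rw [tensorKronecker, h, h', Finset.sum_mul_sum, Fintype.sum_prod_type]
  exact Finset.sum_congr rfl fun t _ => Finset.sum_congr rfl fun t' _ => by ring

/-- `T` is obtained from `T'` by a linear map in each of the three slots. -/
def IsRestriction [Fintype I'] [Fintype J'] [Fintype K'] (T : I → J → K → R)
    (T' : I' → J' → K' → R) : Prop :=
  ∃ (a : I → I' → R) (b : J → J' → R) (c : K → K' → R), ∀ i j k,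
    T i j k = ∑ i', a i i' * ∑ j', b j j' * ∑ k', c k k' * T' i' j' k'

theorem IsRestriction.comap {I'' J'' K'' : Type*} [Fintype I'] [Fintype J'] [Fintype K']
    {T : I → J → K → R} {T' : I' → J' → K' → R} (h : IsRestriction T T') (f : I'' → I)
    (g : J'' → J) (k : K'' → K) : IsRestriction (fun x y z => T (f x) (g y) (k z)) T' := by
  obtain ⟨a, b, c, h⟩ := h
  exact ⟨a ∘ f, b ∘ g, c ∘ k, fun x y z => h (f x) (g y) (k z)⟩

theorem IsRestriction.tensorRank_kronecker_le {I'' J'' K'' : Type*} [Finite I] [Finite J]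
    [Finite K] [Fintype I'] [Fintype J'] [Fintype K'] [Finite I''] [Finite J''] [Finite K'']
    {T : I → J → K → R} {T' : I' → J' → K' → R} (h : IsRestriction T T')
    (Y : I'' → J'' → K'' → R) :
    tensorRank (tensorKronecker T Y) ≤ tensorRank (tensorKronecker T' Y) := by
  obtain ⟨a, b, c, h⟩ := h
  refine tensorRank_le_of_restrict (fun i : I × I'' => a i.1) (fun j : J × J'' => b j.1)
    (fun k : K × K'' => c k.1) (fun i s => (s, i.2)) (fun j s => (s, j.2))
    (fun k s => (s, k.2)) fun i j k => ?_
  simp only [tensorKronecker, h, Finset.sum_mul, mul_assoc]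

end TensorRank

section TensorRankRing

variable {R I J K E : Type*} [CommRing R]

theorem card_le_tensorRank [Nontrivial R] [Fintype I] [Finite J] [Finite K]
    {T : I → J → K → R} (hT : LinearIndependent R T) : Fintype.card I ≤ tensorRank T := by
  obtain ⟨u, v, w, h⟩ := exists_eq_sum_tensorRank T
  let x : Fin (tensorRank T) → J → K → R := fun t j k => v t j * w t k
  have hspan : Set.range T ≤ Submodule.span R (Set.range x) := by
    rintro _ ⟨i, rfl⟩
    have hi : T i = ∑ t, u t i • x t := by
      funext j k
      simp [h, x, Finset.sum_apply, mul_assoc]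
    rw [hi]
    exact Submodule.sum_mem _ fun t _ =>
      Submodule.smul_mem _ _ (Submodule.subset_span ⟨t, rfl⟩)
  classical
  simpa using (linearIndependent_le_span_aux' T hT _ hspan).trans (Fintype.card_range_le x)

theorem tensorRank_le_of_polar [AddCommGroup E] [Module R E]
    (P : Finset (Module.Dual R E × Module.Dual R E)) {q : K → E → R}
    (hq : ∀ k, q k ∈ productSpan (P : Set (Module.Dual R E × Module.Dual R E)))
    (x : I → E) (y : J → E) {T : I → J → K → R}
    (hT : ∀ i j k, T i j k = QuadraticMap.polar (q k) (x i) (y j)) :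
    tensorRank T ≤ 2 * P.card := by
  have hcoeff (k) : ∃ c : P → R,
      ∀ z, q k z = ∑ p, c p * (p.1.1 z * p.1.2 z) := by
    obtain ⟨c, hc⟩ := Submodule.mem_span_image_finset_iff_exists_fun R |>.1 (hq k)
    exact ⟨c, fun z => by simp [← hc]⟩
  choose c hc using hcoeff
  refine (tensorRank_le_card (ι := P ⊕ P)
    (fun t i => t.elim (fun p => p.1.1 (x i)) fun p => p.1.2 (x i))
    (fun t j => t.elim (fun p => p.1.2 (y j)) fun p => p.1.1 (y j))
    (fun t k => t.elim (fun p => c k p) fun p => c k p) fun i j k => ?_).trans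
    (by simp [two_mul])
  rw [Fintype.sum_sum_type]
  simp only [hT, QuadraticMap.polar, hc, Sum.elim_inl, Sum.elim_inr, map_add,
    ← Finset.sum_sub_distrib, ← Finset.sum_add_distrib]
  exact Finset.sum_congr rfl fun p _ => by ring

end TensorRankRing

/-! ### Matrix multiplication tensors -/

section MatMulTensor

/-- The tensor `⟨|A|, |B|, |C|⟩` of the multiplication of an `A × B` matrix by a `B × C` matrix.
The third factor is transposed, as in the trilinear form `tr (XYZ)`, which makes the tensor
invariant under cyclic rotation. -/
def matMulTensor (R A B C : Type*) [CommSemiring R] [DecidableEq A] [DecidableEq B]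
    [DecidableEq C] : A × B → B × C → C × A → R :=
  fun x y z => if x.2 = y.1 ∧ y.2 = z.1 ∧ z.2 = x.1 then 1 else 0

variable {R A B C A' B' C' : Type*} [CommSemiring R]
  [DecidableEq A] [DecidableEq B] [DecidableEq C]
  [DecidableEq A'] [DecidableEq B'] [DecidableEq C']

theorem sum_matMulTensor_smul {M : Type*} [AddCommMonoid M] [Module R M] [Fintype A]
    [Fintype B] [Fintype C] (a : A) (c : C) (f : A × B → B × C → M) :
    ∑ x, ∑ y, matMulTensor R A B C x y (c, a) • f x y = ∑ b, f (a, b) (b, c) := by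
  simp [matMulTensor, Fintype.sum_prod_type, ite_and, ite_smul, Finset.sum_ite_irrel]

theorem single_mul_single_apply_eq_matMulTensor [Fintype B] (x : A × B) (y : B × C)
    (z : C × A) :
    (Matrix.single x.1 x.2 (1 : R) * Matrix.single y.1 y.2 (1 : R)) z.2 z.1 =
      matMulTensor R A B C x y z := by
  by_cases h : x.2 = y.1
  · rw [← h, Matrix.single_mul_single_same]
    simp [matMulTensor, Matrix.single_apply, h, and_comm, eq_comm]
  · simp [matMulTensor, Matrix.single_mul_single_of_ne, h]

theorem matMulTensor_rotate (y : B × C) (z : C × A) (x : A × B) :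
    matMulTensor R B C A y z x = matMulTensor R A B C x y z := by
  unfold matMulTensor
  congr 1
  exact propext (by tauto)

theorem matMulTensor_map {f : A' → A} {g : B' → B} {h : C' → C} (hf : f.Injective)
    (hg : g.Injective) (hh : h.Injective) (x : A' × B') (y : B' × C') (z : C' × A') :
    matMulTensor R A B C (x.map f g) (y.map g h) (z.map h f) = matMulTensor R A' B' C' x y z := by
  simp [matMulTensor, hf.eq_iff, hg.eq_iff, hh.eq_iff]

theorem tensorRank_matMulTensor_le_of_card_le [Fintype A] [Fintype B] [Fintype C] [Fintype A']
    [Fintype B'] [Fintype C'] (hA : Fintype.card A' ≤ Fintype.card A)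
    (hB : Fintype.card B' ≤ Fintype.card B) (hC : Fintype.card C' ≤ Fintype.card C) :
    tensorRank (matMulTensor R A' B' C') ≤ tensorRank (matMulTensor R A B C) := by
  obtain ⟨f⟩ := Function.Embedding.nonempty_of_card_le hA
  obtain ⟨g⟩ := Function.Embedding.nonempty_of_card_le hB
  obtain ⟨h⟩ := Function.Embedding.nonempty_of_card_le hC
  exact tensorRank_le_of_comap (Prod.map f g) (Prod.map g h) (Prod.map h f) fun x y z =>
    (matMulTensor_map f.injective g.injective h.injective x y z).symm

theorem tensorKronecker_matMulTensor (x : (A × B) × (A' × B')) (y : (B × C) × (B' × C'))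
    (z : (C × A) × (C' × A')) :
    tensorKronecker (matMulTensor R A B C) (matMulTensor R A' B' C') x y z =
      matMulTensor R (A × A') (B × B') (C × C') (Equiv.prodProdProdComm A B A' B' x)
        (Equiv.prodProdProdComm B C B' C' y) (Equiv.prodProdProdComm C A C' A' z) := by
  simp only [matMulTensor, tensorKronecker, Prod.ext_iff, ite_zero_mul_ite_zero, mul_one,
    Equiv.prodProdProdComm_apply]
  congr 1
  exact propext (by tauto)

/-- The rank of the tensor `⟨a, b, c⟩`. -/
noncomputable def matMulRank (R : Type*) [CommSemiring R] (a b c : ℕ) : ℕ :=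
  tensorRank (matMulTensor R (Fin a) (Fin b) (Fin c))

variable [Fintype A] [Fintype B] [Fintype C] [Fintype A'] [Fintype B'] [Fintype C']

theorem tensorRank_matMulTensor_eq_matMulRank : tensorRank (matMulTensor R A B C) =
    matMulRank R (Fintype.card A) (Fintype.card B) (Fintype.card C) := by
  apply le_antisymm <;> apply tensorRank_matMulTensor_le_of_card_le <;> simp

theorem tensorRank_kronecker_matMulTensor :
    tensorRank (tensorKronecker (matMulTensor R A B C) (matMulTensor R A' B' C')) =
      matMulRank R (Fintype.card A * Fintype.card A') (Fintype.card B * Fintype.card B')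
        (Fintype.card C * Fintype.card C') := by
  simp only [← Fintype.card_prod, ← tensorRank_matMulTensor_eq_matMulRank]
  refine le_antisymm ?_ ?_
  · exact tensorRank_le_of_comap _ _ _ tensorKronecker_matMulTensor
  · exact tensorRank_le_of_comap (Equiv.prodProdProdComm A A' B B')
      (Equiv.prodProdProdComm B B' C C') (Equiv.prodProdProdComm C C' A A')
      fun x y z => (tensorKronecker_matMulTensor (Equiv.prodProdProdComm A A' B B' x)
        (Equiv.prodProdProdComm B B' C C' y) (Equiv.prodProdProdComm C C' A A' z)).symm

theorem matMulRank_mul_le (a b c a' b' c' : ℕ) :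
    matMulRank R (a * a') (b * b') (c * c') ≤ matMulRank R a b c * matMulRank R a' b' c' := by
  simpa only [tensorRank_kronecker_matMulTensor, tensorRank_matMulTensor_eq_matMulRank,
    Fintype.card_fin] using tensorRank_kronecker_le (matMulTensor R (Fin a) (Fin b) (Fin c))
      (matMulTensor R (Fin a') (Fin b') (Fin c'))

theorem matMulRank_rotate_le (a b c : ℕ) : matMulRank R b c a ≤ matMulRank R a b c :=
  tensorRank_le_of_rotate fun x y z => matMulTensor_rotate y z x

theorem matMulRank_cube_le (a b c : ℕ) :
    matMulRank R (a * b * c) (a * b * c) (a * b * c) ≤ matMulRank R a b c ^ 3 := by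
  calc _ = matMulRank R (a * b * c) (b * c * a) (c * a * b) := by congr 1 <;> ring
    _ ≤ matMulRank R a b c * matMulRank R b c a * matMulRank R c a b :=
        (matMulRank_mul_le _ _ _ _ _ _).trans
          (Nat.mul_le_mul_right _ (matMulRank_mul_le _ _ _ _ _ _))
    _ ≤ matMulRank R a b c * matMulRank R a b c * matMulRank R a b c := by
        gcongr
        · exact matMulRank_rotate_le a b c
        · exact (matMulRank_rotate_le b c a).trans (matMulRank_rotate_le a b c)
    _ = _ := (pow_three' _).symm

theorem linearIndependent_matMulTensor {R A B C : Type*} [CommRing R] [DecidableEq A]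
    [DecidableEq B] [DecidableEq C] [Finite A] [Finite B] [Nonempty C] :
    LinearIndependent R (matMulTensor R A B C) := by
  have := Fintype.ofFinite A
  have := Fintype.ofFinite B
  obtain ⟨c⟩ := ‹Nonempty C›
  refine Fintype.linearIndependent_iff.2 fun g hg x => ?_
  simpa [Finset.sum_apply, matMulTensor, Fintype.sum_prod_type, ite_and, Finset.sum_ite_irrel]
    using congrFun (congrFun hg (x.2, c)) (c, x.1)

theorem mul_le_matMulRank {R : Type*} [CommRing R] [Nontrivial R] (a b c : ℕ) [NeZero c] :
    a * b ≤ matMulRank R a b c := by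
  simpa [tensorRank_matMulTensor_eq_matMulRank] using card_le_tensorRank
    (linearIndependent_matMulTensor :
      LinearIndependent R (matMulTensor R (Fin a) (Fin b) (Fin c)))

theorem isRestriction_trace_mul_mul {I J K n : Type*} [Fintype n] [DecidableEq n]
    (F : I → Matrix n n R) (G : J → Matrix n n R) (H : K → Matrix n n R) :
    IsRestriction (fun i j k => (F i * G j * H k).trace) (matMulTensor R n n n) := by
  refine ⟨fun i x => F i x.1 x.2, fun j y => G j y.1 y.2, fun k z => H k z.1 z.2,
    fun i j k => ?_⟩
  simp [matMulTensor, Matrix.mul_assoc, Matrix.trace, Matrix.mul_apply, Fintype.sum_prod_type,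
    ite_and, Finset.sum_ite_irrel]

end MatMulTensor

theorem MatMulWithin.matMulRank_le {n k : ℕ} (h : MatMulWithin n k) :
    matMulRank ℂ n n n ≤ 2 * k := by
  obtain ⟨P, hPk, hP⟩ := h.exists_productSpan
  refine le_trans ?_ (Nat.mul_le_mul_left 2 hPk)
  exact tensorRank_le_of_polar P (fun z : Fin n × Fin n => hP z.2 z.1)
    (fun x : Fin n × Fin n => (Matrix.single x.1 x.2 1, 0))
    (fun y : Fin n × Fin n => (0, Matrix.single y.1 y.2 1)) fun x y z => by
      simp [QuadraticMap.polar, single_mul_single_apply_eq_matMulTensor]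

/-! ### Fast matrix multiplication by recursion -/

section BilinearAlgorithm

theorem sum_mul_eq_of_matMulTensor_eq_sum {R 𝒜 A B C τ : Type*} [CommSemiring R]
    [NonUnitalSemiring 𝒜] [Module R 𝒜] [IsScalarTower R 𝒜 𝒜] [SMulCommClass R 𝒜 𝒜]
    [Fintype A] [DecidableEq A] [Fintype B] [DecidableEq B] [Fintype C] [DecidableEq C]
    [Fintype τ] {u : τ → A × B → R} {v : τ → B × C → R} {w : τ → C × A → R}
    (h : ∀ x y z, matMulTensor R A B C x y z = ∑ t, u t x * v t y * w t z)
    (F : A × B → 𝒜) (G : B × C → 𝒜) (a : A) (c : C) :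
    ∑ b, F (a, b) * G (b, c) =
      ∑ t, w t (c, a) • ((∑ x, u t x • F x) * ∑ y, v t y • G y) := by
  calc ∑ b, F (a, b) * G (b, c)
      = ∑ x, ∑ y, ∑ t, (u t x * v t y * w t (c, a)) • (F x * G y) := by
        simp only [← sum_matMulTensor_smul (R := R) a c fun x y => F x * G y, h, Finset.sum_smul]
    _ = ∑ t, ∑ x, ∑ y, (u t x * v t y * w t (c, a)) • (F x * G y) :=
        (Finset.sum_congr rfl fun _ _ => Finset.sum_comm).trans Finset.sum_comm
    _ = _ := Finset.sum_congr rfl fun t _ => by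
        rw [Finset.sum_mul_sum, Finset.smul_sum]
        refine Finset.sum_congr rfl fun x _ => ?_
        rw [Finset.smul_sum]
        refine Finset.sum_congr rfl fun y _ => ?_
        rw [smul_mul_smul_comm, smul_smul, mul_comm]

end BilinearAlgorithm

section Recursion

/-- The set of entries of a matrix. -/
def matrixEntries {ι κ α : Type*} (A : Matrix ι κ α) : Set α :=
  Set.range fun p : ι × κ => A p.1 p.2

theorem apply_mem_matrixEntries {ι κ α : Type*} (A : Matrix ι κ α) (i : ι) (j : κ) :
    A i j ∈ matrixEntries A :=
  ⟨(i, j), rfl⟩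

theorem matrixEntries_submatrix_subset {ι κ ι' κ' α : Type*} (A : Matrix ι κ α) (f : ι' → ι)
    (g : κ' → κ) : matrixEntries (A.submatrix f g) ⊆ matrixEntries A := by
  rintro _ ⟨p, rfl⟩
  exact apply_mem_matrixEntries A _ _

variable {ι κ : Type*} [Fintype ι] [Fintype κ] {k : ℕ}

theorem ComputesWithin.matrix_sum_smul {X τ : Type*} [Fintype τ] {inputs : Set (X → ℂ)}
    (c : τ → ℂ) {F : τ → Matrix ι κ (X → ℂ)} (hF : ∀ t, matrixEntries (F t) ⊆ inputs) :
    ComputesWithin inputs (matrixEntries (∑ t, c t • F t))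
      (Fintype.card (ι × κ) * (2 * Fintype.card τ)) := by
  refine .range fun p => ?_
  rw [Matrix.sum_apply]
  exact .sum_smul Finset.univ c fun t _ => hF t (apply_mem_matrixEntries (F t) p.1 p.2)

/-- Two square matrices of functions, indexed by `ι`, can be multiplied with at most `k`
operations. -/
def MatrixProductWithin (ι : Type*) [Fintype ι] (k : ℕ) : Prop :=
  ∀ (X : Type) (A B : Matrix ι ι (X → ℂ)),
    ComputesWithin (matrixEntries A ∪ matrixEntries B) (matrixEntries (A * B)) k

namespace MatrixProductWithin

theorem matMulWithin {n : ℕ} (h : MatrixProductWithin (Fin n) k) : MatMulWithin n k := by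
  let A : Matrix (Fin n) (Fin n) (Matrix (Fin n) (Fin n) ℂ × Matrix (Fin n) (Fin n) ℂ → ℂ) :=
    .of fun i j P => P.1 i j
  let B : Matrix (Fin n) (Fin n) (Matrix (Fin n) (Fin n) ℂ × Matrix (Fin n) (Fin n) ℂ → ℂ) :=
    .of fun i j P => P.2 i j
  have hin : matrixEntries A ∪ matrixEntries B ⊆ matMulInputs n := by
    rintro _ (⟨⟨i, j⟩, rfl⟩ | ⟨⟨i, j⟩, rfl⟩)
    · exact ⟨i, j, Or.inl rfl⟩
    · exact ⟨i, j, Or.inr rfl⟩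
  obtain ⟨L, hL, hlen, hsub⟩ := (h _ A B).inputs_mono hin
  refine ⟨L, hL, hlen, fun i j => ?_⟩
  convert hsub (apply_mem_matrixEntries (A * B) i j) using 1
  funext P
  simp [A, B, Matrix.mul_apply]

theorem of_unique [Unique ι] : MatrixProductWithin ι 1 := by
  intro X A B
  refine (ComputesWithin.of_arithStep (.mul (f := A default default) (g := B default default)
    (subset_availableValues _ _ (Or.inl (apply_mem_matrixEntries A _ _)))
    (subset_availableValues _ _ (Or.inr (apply_mem_matrixEntries B _ _))))).mono ?_ le_rfl
  rintro _ ⟨⟨i, j⟩, rfl⟩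
  rw [Subsingleton.elim i default, Subsingleton.elim j default]
  simp [Matrix.mul_apply, Pi.mul_def]

theorem of_equiv (h : MatrixProductWithin κ k) (e : ι ≃ κ) : MatrixProductWithin ι k := by
  intro X A B
  refine (ComputesWithin.inputs_mono (h X (A.submatrix e.symm e.symm) (B.submatrix e.symm e.symm))
    (Set.union_subset_union (matrixEntries_submatrix_subset A _ _)
      (matrixEntries_submatrix_subset B _ _))).mono ?_ le_rfl
  rw [Matrix.submatrix_mul_equiv]
  simpa using matrixEntries_submatrix_subset ((A * B).submatrix e.symm e.symm) e e

theorem of_sum (h : MatrixProductWithin (ι ⊕ κ) k) : MatrixProductWithin ι k := by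
  intro X A B
  let pad (A : Matrix ι ι (X → ℂ)) : Matrix (ι ⊕ κ) (ι ⊕ κ) (X → ℂ) := .fromBlocks A 0 0 0
  have hpad {inputs} {A : Matrix ι ι (X → ℂ)} (hA : matrixEntries A ⊆ inputs) :
      matrixEntries (pad A) ⊆ availableValues inputs [] := by
    rintro _ ⟨⟨i | i, j | j⟩, rfl⟩
    · exact subset_availableValues _ _ (hA (apply_mem_matrixEntries A i j))
    all_goals exact const_mem_availableValues inputs [] 0
  have hpads := ComputesWithin.of_subset_availableValues (Set.union_subset
    (hpad (Set.subset_union_left (s := matrixEntries A) (t := matrixEntries B)))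
    (hpad Set.subset_union_right))
  refine (hpads.trans (h X (pad A) (pad B))).mono ?_ (zero_add k).le
  have hmul : A * B = (pad A * pad B).submatrix Sum.inl Sum.inl := by
    ext
    simp [pad, Matrix.fromBlocks_multiply]
  rw [hmul]
  exact matrixEntries_submatrix_subset _ _ _

theorem of_card_le (h : MatrixProductWithin κ k) (hcard : Fintype.card ι ≤ Fintype.card κ) :
    MatrixProductWithin ι k := by
  have e : ι ⊕ Fin (Fintype.card κ - Fintype.card ι) ≃ κ :=
    Fintype.equivOfCardEq (by simp [hcard])
  exact (h.of_equiv e).of_sum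

theorem prod {Q : Type*} [Fintype Q] [DecidableEq Q] (h : MatrixProductWithin ι k) {r : ℕ}
    {u v w : Fin r → Q × Q → ℂ}
    (huvw : ∀ x y z, matMulTensor ℂ Q Q Q x y z = ∑ t, u t x * v t y * w t z) :
    MatrixProductWithin (Q × ι) (r * k + 6 * r * Fintype.card Q ^ 2 * Fintype.card ι ^ 2) := by
  intro X A B
  let block (M : Matrix (Q × ι) (Q × ι) (X → ℂ)) (p : Q × Q) : Matrix ι ι (X → ℂ) :=
    M.submatrix (Prod.mk p.1) (Prod.mk p.2)
  let S t := ∑ p, u t p • block A p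
  let T t := ∑ p, v t p • block B p
  have hfactors := (ComputesWithin.iUnion fun t => ComputesWithin.matrix_sum_smul
      (inputs := matrixEntries A ∪ matrixEntries B) (u t) (F := block A) fun p =>
        (matrixEntries_submatrix_subset _ _ _).trans Set.subset_union_left).union
    (ComputesWithin.iUnion fun t => ComputesWithin.matrix_sum_smul (v t) (F := block B) fun p =>
        (matrixEntries_submatrix_subset _ _ _).trans Set.subset_union_right)
  have hproducts := ComputesWithin.iUnion fun t => (h X (S t) (T t)).inputs_mono
    (Set.union_subset_union (Set.subset_iUnion (fun t => matrixEntries (S t)) t)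
      (Set.subset_iUnion (fun t => matrixEntries (T t)) t))
  have hblocks := ComputesWithin.iUnion fun p : Q × Q => ComputesWithin.matrix_sum_smul
    (fun t => w t (p.2, p.1)) (Set.subset_iUnion fun t => matrixEntries (S t * T t))
  have hblock (a c : Q) : block (A * B) (a, c) = ∑ t, w t (c, a) • (S t * T t) := by
    rw [← sum_mul_eq_of_matMulTensor_eq_sum huvw]
    ext i j
    simp [block, Matrix.sum_apply, Matrix.mul_apply, Fintype.sum_prod_type]
  refine ((hfactors.trans hproducts).trans hblocks).mono ?_ (le_of_eq ?_)
  · rintro _ ⟨⟨⟨a, i⟩, ⟨c, j⟩⟩, rfl⟩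
    exact Set.mem_iUnion.2 ⟨(a, c), hblock a c ▸ apply_mem_matrixEntries (block (A * B) (a, c)) i j⟩
  · simp only [Fintype.card_prod, Fintype.card_fin]
    ring

end MatrixProductWithin

end Recursion

theorem sq_le_matMulRank (q : ℕ) : q ^ 2 ≤ matMulRank ℂ q q q := by
  rcases q.eq_zero_or_pos with rfl | hq
  · simp
  · have := NeZero.of_pos hq
    exact (sq q).trans_le (mul_le_matMulRank q q q)

/-- The recurrence `N (j + 1) ≤ r * N j + 6 * r * q ^ 2 * q ^ (2 * j)` with `q ^ 2 ≤ r < ρ`. -/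
theorem exists_matrixProductWithin_pow {q : ℕ} {ρ : ℝ}
    (hρ : matMulRank ℂ q q q < ρ) :
    ∃ K : ℝ, 0 ≤ K ∧ ∀ j : ℕ, ∃ N : ℕ, MatrixProductWithin (Fin (q ^ j)) N ∧ N ≤ K * ρ ^ j := by
  obtain ⟨u, v, w, huvw⟩ := exists_eq_sum_tensorRank (matMulTensor ℂ (Fin q) (Fin q) (Fin q))
  have hqr : (q : ℝ) ^ 2 ≤ matMulRank ℂ q q q := mod_cast sq_le_matMulRank q
  rw [← matMulRank] at u v w
  set r := matMulRank ℂ q q q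
  have hgap : 0 < ρ - r := sub_pos.2 hρ
  let D : ℝ := 6 * r * q ^ 2
  let K : ℝ := 1 + D / (ρ - r)
  have hDK : D ≤ K * (ρ - r) := by
    rw [add_mul, div_mul_cancel₀ _ hgap.ne']
    linarith
  refine ⟨K, by positivity, fun j => ?_⟩
  induction j with
  | zero =>
    refine ⟨1, .of_unique (ι := Fin 1), ?_⟩
    have : 0 ≤ D / (ρ - r) := by positivity
    simpa [K]
  | succ j ih =>
    obtain ⟨N, hN, hNK⟩ := ih
    refine ⟨_, (hN.prod huvw).of_card_le (by simp [pow_succ']), ?_⟩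
    have hqj : ((q : ℝ) ^ j) ^ 2 ≤ ρ ^ j := by
      rw [← pow_mul, mul_comm, pow_mul]
      exact pow_le_pow_left₀ (by positivity) (hqr.trans hρ.le) j
    simp only [Fintype.card_fin, Nat.cast_add, Nat.cast_mul, Nat.cast_pow, Nat.cast_ofNat]
    calc (r : ℝ) * N + D * ((q : ℝ) ^ j) ^ 2
        ≤ r * (K * ρ ^ j) + K * (ρ - r) * ρ ^ j := by gcongr
      _ = K * ρ ^ (j + 1) := by ring

/-! ### The exponent of matrix multiplication -/

theorem le_of_forall_pow_le_const_mul_pow {a b c : ℝ} (hb : 0 ≤ b)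
    (h : ∀ N : ℕ, a ^ N ≤ c * b ^ N) : a ≤ b := by
  by_contra! hba
  have ha : 0 < a := hb.trans_lt hba
  have hlim : Filter.Tendsto (fun N : ℕ => c * (b / a) ^ N) Filter.atTop (nhds (c * 0)) :=
    (tendsto_pow_atTop_nhds_zero_of_lt_one (by positivity) ((div_lt_one ha).2 hba)).const_mul c
  have hge : (1 : ℝ) ≤ c * 0 := ge_of_tendsto' hlim fun N => by
    rw [div_pow, ← mul_div_assoc, one_le_div (pow_pos ha N)]
    exact h N
  linarith

section Exponent

/-- Complex `n × n` matrices can be multiplied with `O(n ^ w)` operations. -/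
def MatMulInTime (w : ℝ) : Prop :=
  ∃ C : ℝ, ∀ n : ℕ, 1 ≤ n → ∃ k : ℕ, MatMulWithin n k ∧ (k : ℝ) ≤ C * (n : ℝ) ^ w

variable {w w' : ℝ}

theorem MatMulInTime.mono (h : MatMulInTime w) (hw : w ≤ w') : MatMulInTime w' := by
  obtain ⟨C, hC⟩ := h
  have hC₀ : 0 ≤ C := by
    obtain ⟨k, -, hk⟩ := hC 1 le_rfl
    exact k.cast_nonneg.trans (by simpa using hk)
  refine ⟨C, fun n hn => ?_⟩
  obtain ⟨k, hnk, hk⟩ := hC n hn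
  refine ⟨k, hnk, hk.trans ?_⟩
  gcongr
  exact_mod_cast hn

theorem MatMulInTime.exists_matMulRank_le (h : MatMulInTime w) :
    ∃ c : ℝ, ∀ n : ℕ, 1 ≤ n → matMulRank ℂ n n n ≤ c * (n : ℝ) ^ w := by
  obtain ⟨C, hC⟩ := h
  refine ⟨2 * C, fun n hn => ?_⟩
  obtain ⟨k, hnk, hk⟩ := hC n hn
  have hrank : (matMulRank ℂ n n n : ℝ) ≤ 2 * k := mod_cast hnk.matMulRank_le
  linarith

theorem MatMulInTime.two_le (h : MatMulInTime w) : 2 ≤ w := by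
  obtain ⟨c, hc⟩ := h.exists_matMulRank_le
  have hpow : (2 : ℝ) ^ (2 : ℝ) ≤ 2 ^ w :=
    le_of_forall_pow_le_const_mul_pow (c := c) (by positivity) fun N => by
      calc ((2 : ℝ) ^ (2 : ℝ)) ^ N = ((2 ^ N) ^ 2 : ℕ) := by
            rw [Real.rpow_two, pow_right_comm]
            norm_cast
        _ ≤ matMulRank ℂ (2 ^ N) (2 ^ N) (2 ^ N) := mod_cast sq_le_matMulRank (2 ^ N)
        _ ≤ c * ((2 ^ N : ℕ) : ℝ) ^ w := hc _ Nat.one_le_two_pow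
        _ = c * ((2 : ℝ) ^ w) ^ N := by
            rw [Nat.cast_pow, Nat.cast_ofNat, Real.rpow_pow_comm zero_le_two]
  exact (Real.rpow_le_rpow_left_iff one_lt_two).1 hpow

theorem matMulInTime_of_matMulRank_lt {q : ℕ} (hq : 2 ≤ q)
    (h : matMulRank ℂ q q q < (q : ℝ) ^ w) : MatMulInTime w := by
  have hq₁ : (1 : ℝ) < q := mod_cast hq
  have hw : 2 ≤ w := by
    have hq₂ : (q : ℝ) ^ (2 : ℝ) < q ^ w := by
      rw [Real.rpow_two]
      exact lt_of_le_of_lt (mod_cast sq_le_matMulRank q) h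
    exact ((Real.rpow_lt_rpow_left_iff hq₁).1 hq₂).le
  obtain ⟨K, hK, hpow⟩ := exists_matrixProductWithin_pow h
  refine ⟨K * (q : ℝ) ^ w, fun n hn => ?_⟩
  have hlt : n < q ^ (Nat.log q n + 1) := Nat.lt_pow_succ_log_self hq n
  obtain ⟨N, hN, hNK⟩ := hpow (Nat.log q n + 1)
  refine ⟨N, (hN.of_card_le (by simpa using hlt.le)).matMulWithin, hNK.trans ?_⟩
  calc K * ((q : ℝ) ^ w) ^ (Nat.log q n + 1)
      = K * q ^ w * ((q ^ Nat.log q n : ℕ) : ℝ) ^ w := by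
        rw [pow_succ', Nat.cast_pow, Real.rpow_pow_comm q.cast_nonneg, mul_assoc]
    _ ≤ K * q ^ w * (n : ℝ) ^ w := by
        gcongr
        exact Nat.pow_log_le_self q (by omega)

theorem nonempty_setOf_matMulInTime_add :
    {w : ℝ | ∀ ε : ℝ, 0 < ε → MatMulInTime (w + ε)}.Nonempty := by
  let r := matMulRank ℂ 2 2 2
  refine ⟨r, fun ε hε => (matMulInTime_of_matMulRank_lt le_rfl ?_ : MatMulInTime r).mono
    (by linarith)⟩
  exact_mod_cast (Nat.lt_two_pow_self : r < 2 ^ r)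

theorem two_mem_lowerBounds_setOf_matMulInTime_add :
    2 ∈ lowerBounds {w : ℝ | ∀ ε : ℝ, 0 < ε → MatMulInTime (w + ε)} :=
  fun _ hw => le_of_forall_pos_le_add fun ε hε => (hw ε hε).two_le

theorem two_le_matMulExponent : 2 ≤ matMulExponent :=
  le_csInf nonempty_setOf_matMulInTime_add two_mem_lowerBounds_setOf_matMulInTime_add

theorem matMulExponent_le (h : MatMulInTime w) : matMulExponent ≤ w :=
  csInf_le ⟨2, two_mem_lowerBounds_setOf_matMulInTime_add⟩ fun _ hε => h.mono (by linarith)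

theorem matMulInTime_of_matMulExponent_lt (h : matMulExponent < w) : MatMulInTime w := by
  obtain ⟨w₀, hw₀, hlt⟩ := exists_lt_of_csInf_lt nonempty_setOf_matMulInTime_add h
  simpa using hw₀ (w - w₀) (sub_pos.2 hlt)

theorem rpow_matMulExponent_le_matMulRank (q : ℕ) :
    (q : ℝ) ^ matMulExponent ≤ matMulRank ℂ q q q := by
  have hsq := sq_le_matMulRank q
  rcases Nat.lt_or_ge q 2 with hq | hq
  · interval_cases q
    · have := two_le_matMulExponent
      simp [Real.zero_rpow (by linarith : matMulExponent ≠ 0)]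
    · simpa using hsq
  · set r := matMulRank ℂ q q q
    have hq₁ : (1 : ℝ) < q := mod_cast hq
    have hr : (0 : ℝ) < r := mod_cast lt_of_lt_of_le (by positivity) hsq
    rw [← Real.le_logb_iff_rpow_le hq₁ hr]
    exact le_of_forall_gt_imp_ge_of_dense fun w hw => matMulExponent_le
      (matMulInTime_of_matMulRank_lt hq ((Real.logb_lt_iff_lt_rpow hq₁ hr).1 hw))

theorem mul_rpow_matMulExponent_le_matMulRank (a b c : ℕ) :
    ((a * b * c : ℕ) : ℝ) ^ matMulExponent ≤ (matMulRank ℂ a b c : ℝ) ^ 3 :=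
  (rpow_matMulExponent_le_matMulRank _).trans (mod_cast matMulRank_cube_le a b c)

end Exponent

section SumOfRestrictions

variable {R τ A B C : Type*} [CommSemiring R] [Fintype τ] [Fintype A] [Fintype B] [Fintype C]
  [DecidableEq A] [DecidableEq B] [DecidableEq C] {d : τ → ℕ}

theorem matMulRank_card_mul_le_sum {T : τ → A × B → B × C → C × A → R}
    (hT : ∀ t, IsRestriction (T t) (matMulTensor R (Fin (d t)) (Fin (d t)) (Fin (d t))))
    (hsum : ∀ x y z, matMulTensor R A B C x y z = ∑ t, T t x y z) (a b c : ℕ) :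
    matMulRank R (Fintype.card A * a) (Fintype.card B * b) (Fintype.card C * c) ≤
      ∑ t, matMulRank R (d t * a) (d t * b) (d t * c) := by
  let Y := matMulTensor R (Fin a) (Fin b) (Fin c)
  have hkronecker : tensorKronecker (matMulTensor R A B C) Y =
      fun x y z => ∑ t, tensorKronecker (T t) Y x y z := by
    funext x y z
    simp only [tensorKronecker, hsum, Finset.sum_mul]
  calc _ = tensorRank (tensorKronecker (matMulTensor R A B C) Y) := by
        simp only [Y, tensorRank_kronecker_matMulTensor, Fintype.card_fin]
    _ ≤ ∑ t, tensorRank (tensorKronecker (T t) Y) := by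
        rw [hkronecker]
        exact tensorRank_sum_le _
    _ ≤ _ := Finset.sum_le_sum fun t _ => (hT t).tensorRank_kronecker_le Y
    _ = _ := by simp only [Y, tensorRank_kronecker_matMulTensor, Fintype.card_fin]

theorem matMulRank_card_pow_mul_le {T : τ → A × B → B × C → C × A → R}
    (hT : ∀ t, IsRestriction (T t) (matMulTensor R (Fin (d t)) (Fin (d t)) (Fin (d t))))
    (hsum : ∀ x y z, matMulTensor R A B C x y z = ∑ t, T t x y z) (hd : ∀ t, d t ≠ 0) {c w : ℝ}
    (hc : ∀ n : ℕ, 1 ≤ n → matMulRank R n n n ≤ c * (n : ℝ) ^ w) (N : ℕ) :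
    ∀ e : ℕ, 1 ≤ e →
      matMulRank R (Fintype.card A ^ N * e) (Fintype.card B ^ N * e) (Fintype.card C ^ N * e) ≤
        c * (∑ t, (d t : ℝ) ^ w) ^ N * (e : ℝ) ^ w := by
  induction N with
  | zero => simpa using hc
  | succ N ih =>
    intro e he
    let r (e : ℕ) := matMulRank R (Fintype.card A ^ N * e) (Fintype.card B ^ N * e)
      (Fintype.card C ^ N * e)
    have hstep : matMulRank R (Fintype.card A ^ (N + 1) * e) (Fintype.card B ^ (N + 1) * e)
        (Fintype.card C ^ (N + 1) * e) ≤ ∑ t, r (d t * e) := by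
      simpa only [r, pow_succ', mul_assoc, mul_left_comm (d _)] using
        matMulRank_card_mul_le_sum hT hsum (Fintype.card A ^ N * e) (Fintype.card B ^ N * e)
          (Fintype.card C ^ N * e)
    calc _ ≤ ∑ t, (r (d t * e) : ℝ) := mod_cast hstep
      _ ≤ ∑ t, c * (∑ t, (d t : ℝ) ^ w) ^ N * ((d t * e : ℕ) : ℝ) ^ w :=
          Finset.sum_le_sum fun t _ => ih _ (Nat.mul_pos (Nat.pos_of_ne_zero (hd t)) he)
      _ = _ := by
          simp only [Nat.cast_mul, Real.mul_rpow (Nat.cast_nonneg _) (Nat.cast_nonneg _)]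
          rw [← Finset.mul_sum, ← Finset.sum_mul]
          ring

/-- An instance of Schönhage's asymptotic sum inequality: the constant factors disappear in the
limit of large Kronecker powers. -/
theorem card_rpow_matMulExponent_le_sum {T : τ → A × B → B × C → C × A → ℂ}
    (hT : ∀ t, IsRestriction (T t) (matMulTensor ℂ (Fin (d t)) (Fin (d t)) (Fin (d t))))
    (hsum : ∀ x y z, matMulTensor ℂ A B C x y z = ∑ t, T t x y z) (hd : ∀ t, d t ≠ 0) :
    ((Fintype.card A * Fintype.card B * Fintype.card C : ℕ) : ℝ) ^ matMulExponent ≤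
      (∑ t, (d t : ℝ) ^ matMulExponent) ^ 3 := by
  set Q := Fintype.card A * Fintype.card B * Fintype.card C
  have hcont : Continuous fun w : ℝ => (∑ t, (d t : ℝ) ^ w) ^ 3 :=
    (continuous_finsetSum _ fun t _ => Real.continuous_const_rpow (mod_cast hd t)).pow 3
  refine ge_of_tendsto (hcont.continuousWithinAt (s := Set.Ioi matMulExponent))
    (eventually_nhdsWithin_of_forall fun w hw => ?_)
  obtain ⟨c, hc⟩ := (matMulInTime_of_matMulExponent_lt hw).exists_matMulRank_le
  refine le_of_forall_pow_le_const_mul_pow (c := c ^ 3)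
    (pow_nonneg (Finset.sum_nonneg fun t _ => by positivity) 3) fun N => ?_
  have hrank := matMulRank_card_pow_mul_le hT hsum hd hc N 1 le_rfl
  simp only [mul_one, Nat.cast_one, Real.one_rpow] at hrank
  calc ((Q : ℝ) ^ matMulExponent) ^ N
      = ((Fintype.card A ^ N * Fintype.card B ^ N * Fintype.card C ^ N : ℕ) : ℝ) ^
          matMulExponent := by
        rw [Real.rpow_pow_comm Q.cast_nonneg, ← mul_pow, ← mul_pow, Nat.cast_pow]
    _ ≤ (matMulRank ℂ (Fintype.card A ^ N) (Fintype.card B ^ N) (Fintype.card C ^ N) : ℝ) ^ 3 :=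
        mul_rpow_matMulExponent_le_matMulRank _ _ _
    _ ≤ (c * (∑ t, (d t : ℝ) ^ w) ^ N) ^ 3 := by gcongr
    _ = c ^ 3 * ((∑ t, (d t : ℝ) ^ w) ^ 3) ^ N := by ring

end SumOfRestrictions

/-! ### The group algebra -/

section GroupAlgebra

theorem exists_forall_eq_trace_mul {R n : Type*} [CommSemiring R] [Fintype n]
    (f : Module.Dual R (Matrix n n R)) : ∃ C : Matrix n n R, ∀ M, f M = (M * C).trace := by
  classical
  refine ⟨Matrix.of fun j i => f (Matrix.single i j 1), fun M => ?_⟩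
  have hsingle (i j) : f (Matrix.single i j (M i j)) = M i j * f (Matrix.single i j 1) := by
    rw [← smul_eq_mul, ← map_smul, Matrix.smul_single, smul_eq_mul, mul_one]
  conv_lhs => rw [Matrix.matrix_eq_sum_single M]
  simp only [map_sum, hsingle, Matrix.trace, Matrix.diag, Matrix.mul_apply, Matrix.of_apply]

theorem exists_forall_eq_sum_trace_mul {R τ : Type*} {n : τ → Type*} [CommSemiring R]
    [Fintype τ] [∀ t, Fintype (n t)]
    (f : Module.Dual R (∀ t, Matrix (n t) (n t) R)) :
    ∃ C : ∀ t, Matrix (n t) (n t) R, ∀ M, f M = ∑ t, (M t * C t).trace := by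
  classical
  choose C hC using fun t =>
    exists_forall_eq_trace_mul (f ∘ₗ LinearMap.single R (fun t => Matrix (n t) (n t) R) t)
  refine ⟨C, fun M => ?_⟩
  conv_lhs => rw [← Finset.univ_sum_single M, map_sum]
  exact Finset.sum_congr rfl fun t _ => hC t (M t)

/-- The tensor of the multiplication of the group algebra `R[G]`, in the trilinear form
`(x, y, z) ↦ (coefficient of 1 in x * y * z)`. -/
def groupTensor (R G : Type*) [CommSemiring R] [Group G] [DecidableEq G] : G → G → G → R :=
  fun g h k => if g * h * k = 1 then 1 else 0

variable {R G : Type*} [CommSemiring R] [Group G]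

theorem exists_groupTensor_eq_sum_trace [DecidableEq G] {τ : Type*} {n : τ → Type*}
    [Fintype τ] [∀ t, Fintype (n t)] [∀ t, DecidableEq (n t)]
    (e : MonoidAlgebra R G ≃ₐ[R] ∀ t, Matrix (n t) (n t) R) :
    ∃ F H : G → ∀ t, Matrix (n t) (n t) R, ∀ g h k,
      groupTensor R G g h k = ∑ t, (F g t * F h t * H k t).trace := by
  let coeffOne : MonoidAlgebra R G →ₗ[R] R :=
    Finsupp.lapply 1 ∘ₗ (MonoidAlgebra.coeffLinearEquiv R).toLinearMap
  obtain ⟨C, hC⟩ := exists_forall_eq_sum_trace_mul (coeffOne ∘ₗ e.symm.toLinearMap)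
  let F (g : G) := e (MonoidAlgebra.of R G g)
  refine ⟨F, fun k => F k * C, fun g h k => ?_⟩
  have hcoeff : groupTensor R G g h k = coeffOne (e.symm (F g * F h * F k)) := by
    simp only [F, ← map_mul, e.symm_apply_apply]
    simp [groupTensor, coeffOne, Finsupp.single_apply]
  rw [hcoeff]
  exact (hC _).trans (by simp only [Pi.mul_apply, mul_assoc])

theorem isCharacterDegree_of_surjective {d : ℕ} [NeZero d]
    (φ : MonoidAlgebra ℂ G →ₐ[ℂ] Matrix (Fin d) (Fin d) ℂ) (hφ : Function.Surjective φ) :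
    IsCharacterDegree G d := by
  let ρ : Representation ℂ G (Fin d → ℂ) :=
    (MonoidAlgebra.lift ℂ _ G).symm (Matrix.toLinAlgEquiv'.toAlgHom.comp φ)
  have hρ : ρ.asAlgebraHom = Matrix.toLinAlgEquiv'.toAlgHom.comp φ :=
    (MonoidAlgebra.lift ℂ _ G).apply_symm_apply _
  refine ⟨ρ, ρ.irreducible_iff_isSimpleModule_asModule.2 ?_⟩
  let σ : MonoidAlgebra ℂ G →+* Module.End ℂ (Fin d → ℂ) := ρ.asAlgebraHom
  have : RingHomSurjective σ :=
    ⟨(congrArg DFunLike.coe hρ).symm ▸ Matrix.toLinAlgEquiv'.surjective.comp hφ⟩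
  let l : ρ.asModule →ₛₗ[σ] (Fin d → ℂ) :=
    { ρ.asModuleEquiv.toAddEquiv with map_smul' := ρ.asModuleEquiv_map_smul }
  exact (LinearMap.isSimpleModule_iff_of_bijective l ρ.asModuleEquiv.bijective).2 inferInstance

theorem finite_monoidAlgebra (R G : Type*) [CommSemiring R] [Finite G] :
    Module.Finite R (MonoidAlgebra R G) :=
  Module.Finite.equiv (MonoidAlgebra.coeffLinearEquiv R).symm

theorem finrank_monoidAlgebra (R G : Type*) [CommRing R] [StrongRankCondition R] [Finite G] :
    Module.finrank R (MonoidAlgebra R G) = Nat.card G := by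
  have := Fintype.ofFinite G
  rw [(MonoidAlgebra.coeffLinearEquiv R).finrank_eq, Module.finrank_finsupp_self,
    Nat.card_eq_fintype_card]

theorem IsCharacterDegree.le_card [Finite G] {d : ℕ} (h : IsCharacterDegree G d) :
    d ≤ Nat.card G := by
  obtain ⟨ρ, hρ⟩ := h
  have := ρ.irreducible_iff_isSimpleModule_asModule.1 hρ
  have := IsSimpleModule.nontrivial (MonoidAlgebra ℂ G) ρ.asModule
  obtain ⟨v, hv⟩ := exists_ne (0 : ρ.asModule)
  let f : MonoidAlgebra ℂ G →ₗ[ℂ] ρ.asModule :=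
    (LinearMap.toSpanSingleton (MonoidAlgebra ℂ G) ρ.asModule v).restrictScalars ℂ
  have hf : Function.Surjective f :=
    IsSimpleModule.toSpanSingleton_surjective (MonoidAlgebra ℂ G) hv
  have := finite_monoidAlgebra ℂ G
  calc d = Module.finrank ℂ ρ.asModule := by
        rw [ρ.asModuleEquiv.finrank_eq, Module.finrank_fin_fun]
    _ ≤ Module.finrank ℂ (MonoidAlgebra ℂ G) := LinearMap.finrank_le_finrank_of_surjective hf
    _ = Nat.card G := finrank_monoidAlgebra ℂ G

theorem IsCharacterDegree.le_max [Finite G] {d : ℕ} (h : IsCharacterDegree G d) :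
    d ≤ maxCharacterDegree G :=
  le_csSup ⟨Nat.card G, fun _ h => h.le_card⟩ h

theorem exists_groupTensor_eq_sum (G : Type*) [Group G] [Finite G] [DecidableEq G] :
    ∃ (s : ℕ) (d : Fin s → ℕ) (T : Fin s → G → G → G → ℂ),
      (∀ t, d t ≠ 0) ∧ (∀ t, IsCharacterDegree G (d t)) ∧ ∑ t, d t ^ 2 = Nat.card G ∧
      (∀ t, IsRestriction (T t) (matMulTensor ℂ (Fin (d t)) (Fin (d t)) (Fin (d t)))) ∧
      ∀ g h k, groupTensor ℂ G g h k = ∑ t, T t g h k := by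
  have := finite_monoidAlgebra ℂ G
  have : NeZero (Nat.card G : ℂ) := ⟨mod_cast Nat.card_pos.ne'⟩
  obtain ⟨s, d, hd, ⟨e⟩⟩ :=
    IsSemisimpleRing.exists_algEquiv_pi_matrix_of_isAlgClosed ℂ (MonoidAlgebra ℂ G)
  obtain ⟨F, H, hFH⟩ := exists_groupTensor_eq_sum_trace e
  refine ⟨s, d, fun t g h k => (F g t * F h t * H k t).trace, fun t => (hd t).ne, fun t => ?_, ?_,
    fun t => isRestriction_trace_mul_mul _ _ _, hFH⟩
  · exact isCharacterDegree_of_surjective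
      ((Pi.evalAlgHom ℂ (fun t => Matrix (Fin (d t)) (Fin (d t)) ℂ) t).comp e.toAlgHom)
      ((Function.surjective_eval t).comp e.surjective)
  · have hfinrank := e.toLinearEquiv.finrank_eq
    rw [finrank_monoidAlgebra, Module.finrank_pi_fintype] at hfinrank
    simpa only [Module.finrank_matrix, Module.finrank_self, Fintype.card_fin, mul_one, ← sq]
      using hfinrank.symm

theorem maxCharacterDegree_pos (G : Type*) [Group G] [Finite G] : 0 < maxCharacterDegree G := by
  classical
  obtain ⟨s, d, -, hd, hdeg, hsum, -⟩ := exists_groupTensor_eq_sum G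
  obtain ⟨t⟩ : Nonempty (Fin s) := by
    by_contra! hs
    exact Nat.card_pos.ne' (hsum.symm.trans (Fintype.sum_empty _))
  exact (Nat.pos_of_ne_zero (hd t)).trans_le (hdeg t).le_max

end GroupAlgebra

/-! ### The triple product property -/

namespace TripleProductProperty

section Group

variable {G : Type*} [Group G] {S T U : Finset G}

theorem eq_of_mul_eq_one (h : TripleProductProperty S T U) {s s' t t' u u' : G} (hs : s ∈ S)
    (hs' : s' ∈ S) (ht : t ∈ T) (ht' : t' ∈ T) (hu : u ∈ U) (hu' : u' ∈ U)
    (hprod : s' * s⁻¹ * (t * t'⁻¹) * (u * u'⁻¹) = 1) : s' = s ∧ t = t' ∧ u = u' := by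
  obtain ⟨hss, htt, huu⟩ :=
    h _ ⟨s', hs', s, hs, rfl⟩ _ ⟨t, ht, t', ht', rfl⟩ _ ⟨u, hu, u', hu', rfl⟩ hprod
  exact ⟨mul_inv_eq_one.1 hss, mul_inv_eq_one.1 htt, mul_inv_eq_one.1 huu⟩

theorem rotate (h : TripleProductProperty S T U) : TripleProductProperty T U S := by
  intro b hb c hc a ha hbca
  obtain ⟨ha₁, hb₁, hc₁⟩ := h a ha b hb c hc (by
    rw [mul_assoc]
    exact mul_eq_one_comm.1 hbca)
  exact ⟨hb₁, hc₁, ha₁⟩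

theorem matMulTensor_eq_groupTensor {R : Type*} [CommSemiring R] [DecidableEq G]
    (h : TripleProductProperty S T U) (x : S × T) (y : T × U) (z : U × S) :
    matMulTensor R S T U x y z =
      groupTensor R G ((x.1 : G)⁻¹ * x.2) ((y.1 : G)⁻¹ * y.2) ((z.1 : G)⁻¹ * z.2) := by
  obtain ⟨s, t⟩ := x
  obtain ⟨t', u⟩ := y
  obtain ⟨u', s'⟩ := z
  simp only [matMulTensor, groupTensor]
  congr 1
  refine propext ⟨?_, fun hprod => ?_⟩
  · rintro ⟨rfl, rfl, rfl⟩
    group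
  · have hconj : (s' : G) * (s : G)⁻¹ * (t * (t' : G)⁻¹) * (u * (u' : G)⁻¹) = 1 := by
      simpa [mul_assoc] using congrArg (fun g : G => (s' : G) * g * (s' : G)⁻¹) hprod
    obtain ⟨hss, htt, huu⟩ := h.eq_of_mul_eq_one s.2 s'.2 t.2 t'.2 u.2 u'.2 hconj
    exact ⟨Subtype.ext htt, Subtype.ext huu, Subtype.ext hss⟩

theorem injOn_inv_mul (h : TripleProductProperty S T U) (hU : U.Nonempty) :
    Set.InjOn (fun x : G × G => x.1⁻¹ * x.2) (S ×ˢ T : Finset (G × G)) := by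
  rintro ⟨s, t⟩ hst ⟨s', t'⟩ hst' heq
  obtain ⟨u, hu⟩ := hU
  simp only [Finset.coe_product, Set.mem_prod, Finset.mem_coe] at hst hst' heq
  have hprod : s' * s⁻¹ * (t * t'⁻¹) * (u * u⁻¹) = 1 :=
    calc _ = s' * (s⁻¹ * t) * t'⁻¹ := by group
      _ = 1 := by rw [heq]; group
  obtain ⟨rfl, rfl, -⟩ := h.eq_of_mul_eq_one hst.1 hst'.1 hst.2 hst'.2 hu hu hprod
  rfl

variable [Finite G]

theorem card_mul_card_le (h : TripleProductProperty S T U) (hU : U.Nonempty) :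
    S.card * T.card ≤ Nat.card G := by
  have := Fintype.ofFinite G
  rw [← Finset.card_product, Nat.card_eq_fintype_card]
  exact Finset.card_le_card_of_injOn _ (fun _ _ => Finset.mem_univ _) (h.injOn_inv_mul hU)

theorem card_mul_card_lt (h : TripleProductProperty S T U) (hU : 2 ≤ U.card) :
    S.card * T.card < Nat.card G := by
  classical
  have := Fintype.ofFinite G
  obtain ⟨u, hu, u', hu', hne⟩ := Finset.one_lt_card.1 hU
  have hinj := h.injOn_inv_mul ⟨u, hu⟩
  refine lt_of_le_of_ne (h.card_mul_card_le ⟨u, hu⟩) fun heq => hne ?_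
  have hpos : 0 < S.card * T.card := heq ▸ Nat.card_pos
  obtain ⟨s', hs'⟩ := Finset.card_pos.1 (Nat.pos_of_mul_pos_right hpos)
  obtain ⟨t', ht'⟩ := Finset.card_pos.1 (Nat.pos_of_mul_pos_left hpos)
  have himage : (S ×ˢ T).image (fun x : G × G => x.1⁻¹ * x.2) = Finset.univ := by
    rw [← Finset.card_eq_iff_eq_univ, Finset.card_image_of_injOn hinj, Finset.card_product, heq,
      Nat.card_eq_fintype_card]
  have hmem : s'⁻¹ * (u * u'⁻¹)⁻¹ * t' ∈ (S ×ˢ T).image (fun x : G × G => x.1⁻¹ * x.2) :=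
    himage ▸ Finset.mem_univ _
  obtain ⟨⟨s, t⟩, hst, hx⟩ := Finset.mem_image.1 hmem
  rw [Finset.mem_product] at hst
  have hprod : s' * s⁻¹ * (t * t'⁻¹) * (u * u'⁻¹) = 1 :=
    calc _ = s' * (s⁻¹ * t) * t'⁻¹ * (u * u'⁻¹) := by group
      _ = 1 := by rw [hx]; group
  exact (h.eq_of_mul_eq_one hst.1 hs' hst.2 ht' hu hu' hprod).2.2

theorem sq_card_lt_of_two_le (h : TripleProductProperty S T U) (hS : S.Nonempty)
    (hT : T.Nonempty) (hU : 2 ≤ U.card) :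
    (S.card * T.card * U.card) ^ 2 < Nat.card G ^ 3 := by
  have hU₀ : U.Nonempty := Finset.card_pos.1 (by omega)
  have hpos : 0 < T.card * U.card * (U.card * S.card) := by positivity
  calc (S.card * T.card * U.card) ^ 2
      = S.card * T.card * (T.card * U.card * (U.card * S.card)) := by ring
    _ < Nat.card G * (T.card * U.card * (U.card * S.card)) :=
        Nat.mul_lt_mul_of_pos_right (h.card_mul_card_lt hU) hpos
    _ ≤ Nat.card G * (Nat.card G * Nat.card G) := by
        gcongr
        · exact h.rotate.card_mul_card_le hS
        · exact h.rotate.rotate.card_mul_card_le hT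
    _ = Nat.card G ^ 3 := (pow_three _).symm

theorem sq_card_lt (h : TripleProductProperty S T U) (hcard : 1 < S.card * T.card * U.card) :
    (S.card * T.card * U.card) ^ 2 < Nat.card G ^ 3 := by
  have hST := Nat.pos_of_mul_pos_right (Nat.zero_lt_one.trans hcard)
  have hU := Nat.pos_of_mul_pos_left (Nat.zero_lt_one.trans hcard)
  have hS := Nat.pos_of_mul_pos_right hST
  have hT := Nat.pos_of_mul_pos_left hST
  have hcases : 2 ≤ U.card ∨ 2 ≤ S.card ∨ 2 ≤ T.card := by
    by_contra! hlt
    simp [show S.card = 1 by omega, show T.card = 1 by omega, show U.card = 1 by omega] at hcard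
  rw [Finset.card_pos] at hS hT hU
  rcases hcases with h₂ | h₂ | h₂
  · exact h.sq_card_lt_of_two_le hS hT h₂
  · convert h.rotate.sq_card_lt_of_two_le hT hU h₂ using 2
    ring
  · convert h.rotate.rotate.sq_card_lt_of_two_le hU hS h₂ using 2
    ring

/-- From the theorem of Cohn and Umans `(nmp) ^ (ω / 3) ≤ ∑ d ^ ω`, where `d` runs over the
character degrees with multiplicity, and `∑ d ^ 2 = |G|`. -/
theorem card_rpow_matMulExponent_le (h : TripleProductProperty S T U) :
    ((S.card * T.card * U.card : ℕ) : ℝ) ^ matMulExponent ≤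
      ((maxCharacterDegree G : ℝ) ^ (matMulExponent - 2) * Nat.card G) ^ 3 := by
  classical
  obtain ⟨s, d, X, hd, hdeg, hsum, hX, hgroup⟩ := exists_groupTensor_eq_sum G
  have hω := two_le_matMulExponent
  calc _ ≤ (∑ t, (d t : ℝ) ^ matMulExponent) ^ 3 := by
        simpa only [Fintype.card_coe] using card_rpow_matMulExponent_le_sum
          (fun t => (hX t).comap (fun x : S × T => (x.1 : G)⁻¹ * x.2)
            (fun y : T × U => (y.1 : G)⁻¹ * y.2) (fun z : U × S => (z.1 : G)⁻¹ * z.2))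
          (fun x y z => (h.matMulTensor_eq_groupTensor x y z).trans (hgroup _ _ _)) hd
    _ ≤ ((maxCharacterDegree G : ℝ) ^ (matMulExponent - 2) * ∑ t, (d t : ℝ) ^ 2) ^ 3 := by
        rw [Finset.mul_sum]
        gcongr with t
        calc (d t : ℝ) ^ matMulExponent = (d t : ℝ) ^ (matMulExponent - 2) * (d t : ℝ) ^ 2 := by
              rw [← Real.rpow_two, ← Real.rpow_add_of_nonneg (Nat.cast_nonneg _) (by linarith)
                zero_le_two, sub_add_cancel]
          _ ≤ (maxCharacterDegree G : ℝ) ^ (matMulExponent - 2) * (d t : ℝ) ^ 2 := by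
              gcongr
              exact (hdeg t).le_max
    _ = _ := by rw [← hsum]; push_cast; rfl

theorem matMulExponent_mul_log_card_le (h : TripleProductProperty S T U)
    (hcard : 0 < S.card * T.card * U.card) :
    matMulExponent * Real.log (S.card * T.card * U.card : ℕ) ≤
      3 * ((matMulExponent - 2) * Real.log (maxCharacterDegree G) + Real.log (Nat.card G)) := by
  have hcard' : (0 : ℝ) < (S.card * T.card * U.card : ℕ) := mod_cast hcard
  have hG : (0 : ℝ) < Nat.card G := mod_cast Nat.card_pos
  have hdeg : (0 : ℝ) < maxCharacterDegree G := mod_cast maxCharacterDegree_pos G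
  have hlog := Real.log_le_log (Real.rpow_pos_of_pos hcard' _) h.card_rpow_matMulExponent_le
  rwa [Real.log_rpow hcard', Real.log_pow,
    Real.log_mul (Real.rpow_pos_of_pos hdeg _).ne' hG.ne', Real.log_rpow hdeg] at hlog

end Group

theorem card_le_of_commGroup {G : Type*} [CommGroup G] [Finite G] {S T U : Finset G}
    (h : TripleProductProperty S T U) : S.card * T.card * U.card ≤ Nat.card G := by
  have := Fintype.ofFinite G
  rw [← Finset.card_product, ← Finset.card_product, Nat.card_eq_fintype_card]
  refine Finset.card_le_card_of_injOn (fun x : (G × G) × G => x.1.1⁻¹ * x.1.2 * x.2)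
    (fun _ _ => Finset.mem_univ _) ?_
  rintro ⟨⟨s, t⟩, u⟩ hx ⟨⟨s', t'⟩, u'⟩ hx' heq
  simp only [Finset.coe_product, Set.mem_prod, Finset.mem_coe] at hx hx' heq
  have hprod : s' * s⁻¹ * (t * t'⁻¹) * (u * u'⁻¹) = 1 :=
    calc _ = (s⁻¹ * t * u) * (s'⁻¹ * t' * u')⁻¹ := by
          simp only [mul_inv_rev, inv_inv, mul_comm, mul_left_comm, mul_assoc]
      _ = 1 := mul_inv_eq_one.2 heq
  obtain ⟨rfl, rfl, rfl⟩ :=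
    h.eq_of_mul_eq_one hx.1.1 hx'.1.1 hx.1.2 hx'.1.2 hx.2 hx'.2 hprod
  rfl

end TripleProductProperty

/-! ### The pseudo-exponent -/

section PseudoExponent

/-- The set whose minimum is the pseudo-exponent of a non-trivial finite group. -/
def pseudoExponentSet (G : Type*) [Group G] : Set ℝ :=
  {x : ℝ | ∃ n m p : ℕ, 0 < n ∧ 0 < m ∧ 0 < p ∧ ¬ (n = 1 ∧ m = 1 ∧ p = 1) ∧
      Realizes G n m p ∧
      x = 3 * Real.log (Nat.card G) / Real.log ((n : ℝ) * (m : ℝ) * (p : ℝ))}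

theorem pseudoExponentSet_nonempty (G : Type*) [Group G] [Finite G] [Nontrivial G] :
    (pseudoExponentSet G).Nonempty := by
  have := Fintype.ofFinite G
  have hcard : 1 < Nat.card G := Finite.one_lt_card
  refine ⟨_, Nat.card G, 1, 1, by omega, one_pos, one_pos, by omega,
    ⟨Finset.univ, {1}, {1}, by simp, by simp, by simp, ?_⟩, rfl⟩
  rintro a - b ⟨_, hs, _, ht, rfl⟩ c ⟨_, hs', _, ht', rfl⟩ hprod
  simp_all

theorem pseudoExponentSet_finite (G : Type*) [Group G] [Finite G] :
    (pseudoExponentSet G).Finite := by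
  refine (Set.finite_range fun F : Finset G × Finset G × Finset G =>
    3 * Real.log (Nat.card G) /
      Real.log ((F.1.card : ℝ) * (F.2.1.card : ℝ) * (F.2.2.card : ℝ))).subset ?_
  rintro _ ⟨_, _, _, -, -, -, -, ⟨S, T, U, rfl, rfl, rfl, -⟩, rfl⟩
  exact ⟨(S, T, U), rfl⟩

theorem exists_pseudoExponent_mul_log_eq (G : Type*) [Group G] [Finite G] [Nontrivial G] :
    ∃ S T U : Finset G, TripleProductProperty S T U ∧ 1 < S.card * T.card * U.card ∧
      pseudoExponent G * Real.log (S.card * T.card * U.card : ℕ) = 3 * Real.log (Nat.card G) := by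
  have hmem : pseudoExponent G ∈ pseudoExponentSet G := by
    rw [pseudoExponent, if_pos ‹_›]
    exact (pseudoExponentSet_nonempty G).csInf_mem (pseudoExponentSet_finite G)
  obtain ⟨_, _, _, hn, hm, hp, hne, ⟨S, T, U, rfl, rfl, rfl, h⟩, hα⟩ := hmem
  have hcard : 1 < S.card * T.card * U.card := by
    refine lt_of_le_of_ne (Nat.mul_pos (Nat.mul_pos hn hm) hp) fun heq => hne ?_
    simpa [and_assoc] using heq.symm
  refine ⟨S, T, U, h, hcard, ?_⟩
  rw [hα, Nat.cast_mul, Nat.cast_mul, div_mul_cancel₀]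
  exact (Real.log_pos (mod_cast hcard)).ne'

theorem two_lt_pseudoExponent (G : Type*) [Group G] [Finite G] [Nontrivial G] :
    2 < pseudoExponent G := by
  obtain ⟨S, T, U, h, hcard, hα⟩ := exists_pseudoExponent_mul_log_eq G
  have hlog : 0 < Real.log (S.card * T.card * U.card : ℕ) := Real.log_pos (mod_cast hcard)
  refine lt_of_mul_lt_mul_right ?_ hlog.le
  have hsq : ((S.card * T.card * U.card : ℕ) : ℝ) ^ 2 < (Nat.card G : ℝ) ^ 3 :=
    mod_cast h.sq_card_lt hcard
  calc 2 * Real.log (S.card * T.card * U.card : ℕ)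
      = Real.log ((S.card * T.card * U.card : ℕ) ^ 2) := by simp [Real.log_pow]
    _ < Real.log (Nat.card G ^ 3) := Real.log_lt_log (by positivity) hsq
    _ = pseudoExponent G * Real.log (S.card * T.card * U.card : ℕ) := by
        rw [hα, Real.log_pow, Nat.cast_ofNat]

theorem three_le_pseudoExponent (G : Type*) [CommGroup G] [Finite G] : 3 ≤ pseudoExponent G := by
  by_cases hG : Nontrivial G
  · obtain ⟨S, T, U, h, hcard, hα⟩ := exists_pseudoExponent_mul_log_eq G
    have hlog : 0 < Real.log (S.card * T.card * U.card : ℕ) := Real.log_pos (mod_cast hcard)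
    refine le_of_mul_le_mul_right ?_ hlog
    rw [hα]
    gcongr
    exact h.card_le_of_commGroup
  · rw [pseudoExponent, if_neg hG]

theorem matMulExponent_mul_log_card_le (G : Type*) [Group G] [Finite G] [Nontrivial G] :
    matMulExponent * Real.log (Nat.card G) ≤ pseudoExponent G *
      ((matMulExponent - 2) * Real.log (maxCharacterDegree G) + Real.log (Nat.card G)) := by
  obtain ⟨S, T, U, h, hcard, hα⟩ := exists_pseudoExponent_mul_log_eq G
  have hα₀ : 0 ≤ pseudoExponent G := (zero_lt_two.trans (two_lt_pseudoExponent G)).le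
  have hTPP := mul_le_mul_of_nonneg_left (h.matMulExponent_mul_log_card_le (by omega)) hα₀
  linear_combination hTPP / 3 - matMulExponent / 3 * hα

variable {G : Type*} [Group G] [Finite G]

theorem matMulExponent_le_of_log_card_eq [Nontrivial G] {γ c : ℝ} (hγ : 2 < γ)
    (hcard : Real.log (Nat.card G) = γ * Real.log (maxCharacterDegree G))
    (hα : pseudoExponent G - 2 ≤ c * (γ - 2)) :
    matMulExponent ≤ pseudoExponent G + matMulExponent * c := by
  have hG : 0 < Real.log (Nat.card G) := Real.log_pos (mod_cast Finite.one_lt_card)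
  have hdeg : 0 < Real.log (maxCharacterDegree G) :=
    pos_of_mul_pos_right (hcard ▸ hG) (by linarith)
  have hω : matMulExponent * γ ≤ pseudoExponent G * (matMulExponent - 2 + γ) := by
    have hlog := matMulExponent_mul_log_card_le G
    rw [hcard] at hlog
    refine le_of_mul_le_mul_right ?_ hdeg
    linear_combination hlog
  have hωα := mul_le_mul_of_nonneg_left hα (zero_le_two.trans two_le_matMulExponent)
  refine le_of_mul_le_mul_right ?_ (sub_pos.2 hγ)
  linear_combination hω + hωα

theorem matMulExponent_le_of_abs_pseudoExponent_sub_two_le (hα : pseudoExponent G < 3) {c : ℝ}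
    (hc : 0 < c)
    (hγ : ((|pseudoExponent G - 2| : ℝ) : EReal) ≤ (c : EReal) * (degreeExponent G - 2)) :
    matMulExponent ≤ pseudoExponent G + matMulExponent * c := by
  have hncomm : ¬ ∀ a b : G, a * b = b * a := fun hcomm =>
    let _ : CommGroup G := { ‹Group G› with mul_comm := hcomm }
    hα.not_ge (three_le_pseudoExponent G)
  have : Nontrivial G := by
    by_contra hG
    rw [not_nontrivial_iff_subsingleton] at hG
    exact hncomm fun _ _ => Subsingleton.elim _ _
  set γ := Real.log (Nat.card G) / Real.log (maxCharacterDegree G) with hγ_def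
  have hγ' : |pseudoExponent G - 2| ≤ c * (γ - 2) := by
    rw [degreeExponent, if_neg hncomm] at hγ
    rw [← EReal.coe_le_coe_iff, EReal.coe_mul, EReal.coe_sub]
    exact hγ
  have hα₂ := two_lt_pseudoExponent G
  rw [abs_of_pos (sub_pos.2 hα₂)] at hγ'
  have hγ₂ : 2 < γ := sub_pos.1 (pos_of_mul_pos_right ((sub_pos.2 hα₂).trans_le hγ') hc.le)
  refine matMulExponent_le_of_log_card_eq hγ₂ ?_ hγ'
  have hdeg : Real.log (maxCharacterDegree G) ≠ 0 := fun h => by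
    rw [hγ_def, h, div_zero] at hγ₂
    linarith
  exact (div_mul_cancel₀ _ hdeg).symm

end PseudoExponent

theorem mainTheorem4_general {ι : Type*} {l : Filter ι} [l.NeBot] {G : ι → Type*}
    [∀ i, Group (G i)] [∀ i, Finite (G i)]
    (hα : Filter.Tendsto (fun i => pseudoExponent (G i)) l (nhds (2 : ℝ)))
    (hγ : ∀ c : ℝ, 0 < c → ∀ᶠ i in l,
      ((|pseudoExponent (G i) - 2| : ℝ) : EReal) ≤ (c : EReal) * (degreeExponent (G i) - 2)) :
    matMulExponent = 2 := by
  refine le_antisymm ?_ two_le_matMulExponent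
  have hle (c : ℝ) (hc : 0 < c) : matMulExponent ≤ 2 + matMulExponent * c :=
    ge_of_tendsto (hα.add_const _) <| by
      filter_upwards [hα.eventually_lt_const (by norm_num : (2 : ℝ) < 3), hγ c hc] with i hi hγi
      exact matMulExponent_le_of_abs_pseudoExponent_sub_two_le hi hc hγi
  have hlim : Filter.Tendsto (fun c : ℝ => 2 + matMulExponent * c) (nhdsWithin 0 (Set.Ioi 0))
      (nhds 2) :=
    tendsto_nhdsWithin_of_tendsto_nhds (Continuous.tendsto' (by fun_prop) _ _ (by simp))
  exact ge_of_tendsto hlim (eventually_nhdsWithin_of_forall hle)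

theorem mainTheorem4 {G : ℕ → Type*} [∀ i, Group (G i)] [∀ i, Finite (G i)]
    (hα : Filter.Tendsto (fun i => pseudoExponent (G i)) Filter.atTop (nhds (2 : ℝ)))
    (hγ : ∀ c : ℝ, 0 < c → ∀ᶠ i in Filter.atTop,
      ((|pseudoExponent (G i) - 2| : ℝ) : EReal) ≤ (c : EReal) * (degreeExponent (G i) - 2)) :
    matMulExponent = 2 :=
  mainTheorem4_general hα hγ
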